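/- Let $M$ and $\bar M$ be smooth Hausdorff manifolds (without boundary) of the same dimension $n$ (for instance Riemannian manifolds; no metric enters the statement), and let $\Omega\subset M$, $\bar\Omega\subset\bar M$ be non-empty connected open sets with compact closures. Let $c=c(x,\bar x)$ be a real-valued cost which is $C^4$ in the following mixed sense: in local coordinates all mixed derivatives of $c$ of order at most two in $x$ and at most two in $\bar x$ exist on $\Omega\times\bar\Omega$ and extend continuously to $\Omega^{\mathrm{cl}}\times\bar\Omega^{\mathrm{cl}}$. Write $D$, $\bar D$ for the differentials in $x$ and in $\bar x$. Assume: (Twist) for all $x_0\in\Omega$, $\bar x_0\in\bar\Omega$ the maps $\bar x\mapsto -Dc(x_0,\bar x)\in T^*_{x_0}M$ on $\bar\Omega$ and $x\mapsto-\bar Dc(x,\bar x_0)\in T^*_{\bar x_0}\bar M$ on $\Omega$ are injective; (Nondeg) for all $(x,\bar x)\in\Omega^{\mathrm{cl}}\times\bar\Omega^{\mathrm{cl}}$ the linear maps $-\bar DDc(x,\bar x):T_{\bar x}\bar M\to T^*_xM$ and $-D\bar Dc(x,\bar x):T_xM\to T^*_{\bar x}\bar M$ are invertible; (DomConv) $\Omega$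 and $\bar\Omega$ are $c$-convex with respect to each other: for $x\in\Omega$ and $\bar x_0,\bar x_1\in\bar\Omega$, for every $t\in[0,1]$ there is $\bar x(t)\in\bar\Omega$ with $-Dc(x,\bar x(t))=-(1-t)Dc(x,\bar x_0)-tDc(x,\bar x_1)$ (by (Twist) it is unique; $t\mapsto\bar x(t)$ is called the $c$-segment with respect to $x$ from $\bar x_0$ to $\bar x_1$), and symmetrically, for $\bar x\in\bar\Omega$ and $x_0,x_1\in\Omega$ the $c$-segment $x(s)\in\Omega$, $s\in[0,1]$, with respect to $\bar x$ from $x_0$ to $x_1$, given by $-\bar Dc(x(s),\bar x)=-(1-s)\bar Dc(x_0,\bar x)-s\bar Dc(x_1,\bar x)$, exists. Then the following two conditions are equivalent. (A3w) For all $x\in\Omega$, $\bar x\in\bar\Omega$, $V\in T_xM$ and $\eta\in T_x^*M$ with $\langle\eta,V\rangle=0$, one has, in local coordinates near $x$ and $\bar x$, $$\bigl(-c_{ij,\bar p\bar q}+c_{ij,\bar r}\,c^{\bar r,s}\,c_{s,\bar p\bar q}\bigr)c^{\bar p,k}c^{\bar q,l}\,V^iV^j\eta_k\eta_l\ \ge\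 0$$ at $(x,\bar x)$, where indices before (after) the comma denote derivatives in $x$ (in $\bar x$), and $(c^{\bar p,k})$ is the inverse matrix of $(c_{k,\bar p})$. (QQConv) There is a constant $K\ge1$ such that for all $x,x_0,x_1\in\Omega$ and $\bar x,\bar x_0,\bar x_1\in\bar\Omega$ and all $s,t\in[0,1]$, $$-c(x,\bar x(t))+c(x,\bar x_0)+c(x_0,\bar x(t))-c(x_0,\bar x_0)\le Kt\,\bigl(-c(x,\bar x_1)+c(x,\bar x_0)+c(x_0,\bar x_1)-c(x_0,\bar x_0)\bigr)_+,$$ $$-c(x(s),\bar x)+c(x_0,\bar x)+c(x(s),\bar x_0)-c(x_0,\bar x_0)\le Ks\,\bigl(-c(x_1,\bar x)+c(x_0,\bar x)+c(x_1,\bar x_0)-c(x_0,\bar x_0)\bigr)_+,$$ where $\bar x(t)$ is the $c$-segment with respect to $x_0$ from $\bar x_0$ to $\bar x_1$, and $x(s)$ is the $c$-segment with respect to $\bar x_0$ from $x_0$ to $x_1$. -/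

import Mathlib

open Set Filter Topology
open scoped Manifold ContDiff

noncomputable section

namespace CConvexGeometry

/-- The model space of `n`-dimensional manifolds. -/
abbrev Model (n : ℕ) : Type := EuclideanSpace ℝ (Fin n)

/-! ### Partial derivatives of a function of two variables in `ℝⁿ` -/

section Local

variable {n : ℕ} {F : Type*} [NormedAddCommGroup F] [NormedSpace ℝ F]

/-- Derivative in the first variable. -/
def dX (f : Model n → Model n → F) (u v : Model n) : Model n →L[ℝ] F :=
  fderiv ℝ (fun u' => f u' v) u

/-- Derivative in the second variable. -/
def dY (f : Model n → Model n → F) (u v : Model n) : Model n →L[ℝ] F :=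
  fderiv ℝ (fun v' => f u v') v

/-- `g`, defined on `S`, has a continuous extension to `T` (used for `S ⊆ T ⊆ closure S`):
it has a limit along `S` at every point of `T`; at the points of `S` itself this is continuity
along `S`. -/
def ExtendsTo (S T : Set (Model n × Model n)) (g : Model n → Model n → F) : Prop :=
  ∀ q ∈ T, ∃ l : F, Tendsto (fun r : Model n × Model n => g r.1 r.2) (𝓝[S] q) (𝓝 l)

/-- On the open set `S`, `g` is twice differentiable in its second variable, and `g` and these
derivatives extend continuously to `T`. -/
def TwiceY (S T : Set (Model n × Model n)) (g : Model n → Model n → F) : Prop :=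
  (∀ q ∈ S, DifferentiableAt ℝ (fun v => g q.1 v) q.2) ∧
  (∀ q ∈ S, DifferentiableAt ℝ (fun v => dY g q.1 v) q.2) ∧
  ExtendsTo S T g ∧ ExtendsTo S T (dY g) ∧ ExtendsTo S T (dY (dY g))

/-- On the open set `S`, all mixed derivatives of `f` of order at most `2` in the first variable
and at most `2` in the second variable exist, and they extend continuously to `T`.  (By Schwarz's
theorem the order of differentiation does not matter.) -/
def MixedC22 (S T : Set (Model n × Model n)) (f : Model n → Model n → ℝ) : Prop :=
  (∀ q ∈ S, DifferentiableAt ℝ (fun u => f u q.2) q.1) ∧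
  (∀ q ∈ S, DifferentiableAt ℝ (fun u => dX f u q.2) q.1) ∧
  TwiceY S T f ∧ TwiceY S T (dX f) ∧ TwiceY S T (dX (dX f))

/-- The Ma–Trudinger–Wang tensor in coordinates:
`(- c_{ij p̄ q̄} + c_{ij r̄} c^{r̄ s} c_{s p̄ q̄}) c^{p̄ k} c^{q̄ l} Vⁱ Wʲ η_k ζ_l`.
Here `dY (dX f) u v` is the map `b ↦ c_{i p̄} bᵖ`, and its inverse is `η ↦ c^{p̄ k} η_k`. -/
def MTW (f : Model n → Model n → ℝ) (u v V W : Model n) (η ζ : Model n →L[ℝ] ℝ) : ℝ :=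
  let inv : (Model n →L[ℝ] ℝ) →L[ℝ] Model n := (dY (dX f) u v).inverse
  let a := inv η
  let b := inv ζ
  (-(dY (dY (dX (dX f))) u v a b V W)
    + dY (dX (dX f)) u v (inv (dY (dY (dX f)) u v a b)) V W)

end Local

/-! ### Costs on a product of manifolds -/

section Cost

variable {n : ℕ}
  {M : Type*} [TopologicalSpace M] [ChartedSpace (Model n) M]
  {N : Type*} [TopologicalSpace N] [ChartedSpace (Model n) N]

/-- The cost in the coordinates given by charts `φ` of `M` and `ψ` of `N`. -/
def localRep (c : M → N → ℝ) (φ : OpenPartialHomeomorph M (Model n))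
    (ψ : OpenPartialHomeomorph N (Model n)) : Model n → Model n → ℝ :=
  fun u v => c (φ.symm u) (ψ.symm v)

/-- The part of `A × B` in the domain of the charts `φ`, `ψ`, in coordinates. -/
def chartProd (A : Set M) (B : Set N) (φ : OpenPartialHomeomorph M (Model n))
    (ψ : OpenPartialHomeomorph N (Model n)) : Set (Model n × Model n) :=
  (φ '' (A ∩ φ.source)) ×ˢ (ψ '' (B ∩ ψ.source))

/-- The cost is `C⁴` in the mixed sense: in any smooth coordinates, the mixed derivatives of order
at most two in each variable exist on `Ω × Ω'` and are continuous up to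
`closure Ω × closure Ω'`. -/
def IsMixedC4 (c : M → N → ℝ) (Ω : Set M) (Ω' : Set N) : Prop :=
  ∀ φ ∈ IsManifold.maximalAtlas 𝓘(ℝ, Model n) ∞ M,
  ∀ ψ ∈ IsManifold.maximalAtlas 𝓘(ℝ, Model n) ∞ N,
    MixedC22 (chartProd Ω Ω' φ ψ) (chartProd (closure Ω) (closure Ω') φ ψ) (localRep c φ ψ)

/-- `- D c (x, y)`, minus the differential of `c` in its first variable, a covector at `x`. -/
def negD (n : ℕ) {M : Type*} [TopologicalSpace M] [ChartedSpace (Model n) M] {N : Type*}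
    (c : M → N → ℝ) (x : M) (y : N) : TangentSpace 𝓘(ℝ, Model n) x →L[ℝ] ℝ :=
  -(show TangentSpace 𝓘(ℝ, Model n) x →L[ℝ] ℝ from
    mfderiv 𝓘(ℝ, Model n) 𝓘(ℝ, ℝ) (fun x' => c x' y) x)

/-- The twist condition. The second half is the first one for the cost with exchanged variables. -/
def Twist (n : ℕ) {M : Type*} [TopologicalSpace M] [ChartedSpace (Model n) M]
    {N : Type*} [TopologicalSpace N] [ChartedSpace (Model n) N]
    (c : M → N → ℝ) (Ω : Set M) (Ω' : Set N) : Prop :=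
  (∀ x ∈ Ω, InjOn (fun y => negD n c x y) Ω') ∧
  (∀ y ∈ Ω', InjOn (fun x => negD n (flip c) y x) Ω)

/-- Nondegeneracy up to the boundary: at every point of `closure Ω × closure Ω'` the mixed second
derivative of the cost (at boundary points: its continuous extension) and its adjoint are
invertible. -/
def Nondeg (c : M → N → ℝ) (Ω : Set M) (Ω' : Set N) : Prop :=
  ∀ φ ∈ IsManifold.maximalAtlas 𝓘(ℝ, Model n) ∞ M,
  ∀ ψ ∈ IsManifold.maximalAtlas 𝓘(ℝ, Model n) ∞ N,
  ∀ q ∈ chartProd (closure Ω) (closure Ω') φ ψ,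
    letI B : Model n →L[ℝ] (Model n →L[ℝ] ℝ) :=
      extendFrom (chartProd Ω Ω' φ ψ)
        (fun r : Model n × Model n => dY (dX (localRep c φ ψ)) r.1 r.2) q
    (-B).IsInvertible ∧ (-B.flip).IsInvertible

/-- `γ`, on `[0,1]`, is the `c`-segment in `Ω'` with respect to `x` from `y₀` to `y₁`: the point
`γ t` is the `c`-exponential of `(1 - t) p₀ + t p₁` where `pᵢ = - D c (x, yᵢ)`, i.e. the element
of `Ω'` (unique under the twist condition) at which `- D c (x, ·)` has that value. -/
def IsCSegment (n : ℕ) {M : Type*} [TopologicalSpace M] [ChartedSpace (Model n) M] {N : Type*}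
    (c : M → N → ℝ) (Ω' : Set N) (x : M) (y₀ y₁ : N) (γ : ℝ → N) : Prop :=
  ∀ t ∈ Icc (0 : ℝ) 1, γ t ∈ Ω' ∧
    negD n c x (γ t) = (1 - t) • negD n c x y₀ + t • negD n c x y₁

/-- `Ω` and `Ω'` are `c`-convex with respect to each other. -/
def DomConv (n : ℕ) {M : Type*} [TopologicalSpace M] [ChartedSpace (Model n) M]
    {N : Type*} [TopologicalSpace N] [ChartedSpace (Model n) N]
    (c : M → N → ℝ) (Ω : Set M) (Ω' : Set N) : Prop :=
  (∀ y ∈ Ω', ∀ x₀ ∈ Ω, ∀ x₁ ∈ Ω, ∃ σ : ℝ → M, IsCSegment n (flip c) Ω y x₀ x₁ σ) ∧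
  (∀ x ∈ Ω, ∀ y₀ ∈ Ω', ∀ y₁ ∈ Ω', ∃ γ : ℝ → N, IsCSegment n c Ω' x y₀ y₁ γ)

/-- The weak Ma–Trudinger–Wang condition. -/
def A3w (c : M → N → ℝ) (Ω : Set M) (Ω' : Set N) : Prop :=
  ∀ φ ∈ IsManifold.maximalAtlas 𝓘(ℝ, Model n) ∞ M,
  ∀ ψ ∈ IsManifold.maximalAtlas 𝓘(ℝ, Model n) ∞ N,
  ∀ x ∈ Ω ∩ φ.source, ∀ y ∈ Ω' ∩ ψ.source,
  ∀ (V : Model n) (η : Model n →L[ℝ] ℝ), η V = 0 →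
    0 ≤ MTW (localRep c φ ψ) (φ x) (ψ y) V V η η

/-- Quantitative quasiconvexity, with a constant that does not depend on the points. -/
def QQConv (n : ℕ) {M : Type*} [TopologicalSpace M] [ChartedSpace (Model n) M]
    {N : Type*} [TopologicalSpace N] [ChartedSpace (Model n) N]
    (c : M → N → ℝ) (Ω : Set M) (Ω' : Set N) : Prop :=
  ∃ K : ℝ, 1 ≤ K ∧
    ∀ x ∈ Ω, ∀ x₀ ∈ Ω, ∀ x₁ ∈ Ω, ∀ y ∈ Ω', ∀ y₀ ∈ Ω', ∀ y₁ ∈ Ω',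
      (∀ γ : ℝ → N, IsCSegment n c Ω' x₀ y₀ y₁ γ → ∀ t ∈ Icc (0 : ℝ) 1,
        -c x (γ t) + c x y₀ - (-c x₀ (γ t) + c x₀ y₀)
          ≤ K * t * max (-c x y₁ + c x y₀ - (-c x₀ y₁ + c x₀ y₀)) 0) ∧
      (∀ σ : ℝ → M, IsCSegment n (flip c) Ω y₀ x₀ x₁ σ → ∀ s ∈ Icc (0 : ℝ) 1,
        -c (σ s) y + c x₀ y - (-c (σ s) y₀ + c x₀ y₀)
          ≤ K * s * max (-c x₁ y + c x₀ y - (-c x₁ y₀ + c x₀ y₀)) 0)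

end Cost

end CConvexGeometry

end

/-!
Write, in charts, `B = ∂_y ∂ₓ c` for the mixed second derivative of the cost, and `R(V, V, a, a)` for
the Ma–Trudinger–Wang tensor with the covector `η` replaced by the vector `a` with `B a = η`
(`crossCurv`). In this form (A3w) says that `R(V, V, a, a) ≥ 0` whenever `B a V = 0`, and it is
symmetric under the exchange of the two variables by Schwarz's theorem (`crossCurv_flip`).

Both implications rest on one computation. Let `γ` be a `c`-segment with respect to `x₀`, let
`f(t) = -c(x, γ t) + c(x₀, γ t)`, and fix a parameter `t` and the point `y = γ t`, with velocity `a`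
and acceleration `w` of `γ` there. Then `f''(t) = -(Φ(x) - Φ(x₀))`, where
`Φ(z) = D²_y c(z, y)(a, a) + D_y c(z, y) w`. Along the `c`-segment `σ` with respect to `y` from `x₀`
to `x` the second term of `Φ` is affine, the equation for `w` says that `Φ ∘ σ` is critical at `x₀`
(`IsSegmentOn.deriv_hess_zero`), and the equation for the acceleration of `σ` gives
`(Φ ∘ σ)'' = -R(σ', σ', a, a)` (`IsSegmentOn.exists_deriv_hess`). The pairing `B a σ'` is constant
along `σ`, equal to `-f'(t)`.

If (A3w) holds, correcting `a` to a vector that is null with `σ'` gives `R ≥ -C |B a σ'|`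
(`BoundAt.neg_le_crossCurv`), with a uniform `C` because the closures of the domains are compact and
the cost is regular and nondegenerate up to the boundary. Hence `f'' ≥ -C |f'|`, and this
differential inequality implies quantitative quasiconvexity with a constant that depends on `C` only
(`sub_le_of_neg_abs_deriv_le`). The second inequality is the first one for the exchanged variables.

Conversely, if `R(V, V, a, a) < 0` at a null pair, let `σ` and `γ` start with velocities `V`, `a`.
For `x` on `σ` close to `x₀` one finds `f'(0) = 0` and `f''(0) < 0`, so that `f` has a strict local
maximum in the interior of a `c`-segment (`QQConvLeft.crossNonneg`). Quasiconvexity, applied to the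
segment in both orientations, excludes this.
-/

-- needed for the normed space instances on iterated spaces of continuous linear maps
set_option maxSynthPendingDepth 3

namespace CConvexGeometry

/-! ### Schwarz's theorem and mixed regularity -/

section Rearrange

variable (E : Type*) [NormedAddCommGroup E] [NormedSpace ℝ E]
  (F : Type*) [NormedAddCommGroup F] [NormedSpace ℝ F]

/-- Transposition of bilinear maps, as a continuous linear map. -/
noncomputable def transposeL : (E →L[ℝ] E →L[ℝ] F) →L[ℝ] (E →L[ℝ] E →L[ℝ] F) :=
  (ContinuousLinearMap.flipₗᵢ ℝ E E F).toContinuousLinearEquiv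

/-- Transposition of the last two arguments of trilinear maps. -/
noncomputable def transposeR :
    (E →L[ℝ] E →L[ℝ] E →L[ℝ] F) →L[ℝ] (E →L[ℝ] E →L[ℝ] E →L[ℝ] F) :=
  ContinuousLinearMap.compL ℝ E (E →L[ℝ] E →L[ℝ] F) (E →L[ℝ] E →L[ℝ] F) (transposeL E F)

/-- The rearrangement `(a, b, V) ↦ (V, a, b)` of the arguments of a trilinear map. -/
noncomputable def cycle :
    (E →L[ℝ] E →L[ℝ] E →L[ℝ] F) →L[ℝ] (E →L[ℝ] E →L[ℝ] E →L[ℝ] F) :=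
  (transposeL E (E →L[ℝ] F)).comp (transposeR E F)

/-- The rearrangement `(V, a, b, W) ↦ (V, W, a, b)` of the arguments of a quadrilinear map. -/
noncomputable def cycleR :
    (E →L[ℝ] E →L[ℝ] E →L[ℝ] E →L[ℝ] F) →L[ℝ] (E →L[ℝ] E →L[ℝ] E →L[ℝ] E →L[ℝ] F) :=
  ContinuousLinearMap.compL ℝ E (E →L[ℝ] E →L[ℝ] E →L[ℝ] F) (E →L[ℝ] E →L[ℝ] E →L[ℝ] F)
    (cycle E F)

variable {E F}

theorem hasFDerivAt_flip {g : E → E →L[ℝ] E →L[ℝ] F} {g' : E →L[ℝ] E →L[ℝ] E →L[ℝ] F} {x : E}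
    (h : HasFDerivAt g g' x) : HasFDerivAt (fun y => (g y).flip) (transposeR E F g') x :=
  HasFDerivAt.comp (g := transposeL E F) x (transposeL E F).hasFDerivAt h

theorem hasFDerivAt_cycle {g : E → E →L[ℝ] E →L[ℝ] E →L[ℝ] F}
    {g' : E →L[ℝ] E →L[ℝ] E →L[ℝ] E →L[ℝ] F} {x : E}
    (h : HasFDerivAt g g' x) : HasFDerivAt (fun y => cycle E F (g y)) (cycleR E F g') x :=
  HasFDerivAt.comp (g := cycle E F) x (cycle E F).hasFDerivAt h

end Rearrange

section Schwarz

variable {n : ℕ} {F : Type*} [NormedAddCommGroup F] [NormedSpace ℝ F]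

/-- Schwarz's theorem, in the form that creates a derivative: if `∂ₓ f` and `∂_y f` exist near `q`
and `∂_y ∂ₓ f` exists near `q` and is continuous at `q`, then `∂ₓ ∂_y f` exists at `q`, and it is
the transpose of `∂_y ∂ₓ f`. -/
theorem hasFDerivAt_dY_of_dY_dX {f : Model n → Model n → F} {q : Model n × Model n}
    (hx : ∀ᶠ r in 𝓝 q, DifferentiableAt ℝ (fun u => f u r.2) r.1)
    (hy : ∀ᶠ r in 𝓝 q, DifferentiableAt ℝ (fun v => f r.1 v) r.2)
    (hxy : ∀ᶠ r in 𝓝 q, DifferentiableAt ℝ (fun v => dX f r.1 v) r.2)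
    (hc : ContinuousAt (fun r : Model n × Model n => dY (dX f) r.1 r.2) q) :
    HasFDerivAt (fun u => dY f u q.2) (dY (dX f) q.1 q.2).flip q.1 := by
  obtain ⟨u₀, v₀⟩ := q
  set L := dY (dX f) u₀ v₀ with hL
  refine HasFDerivAt.of_isLittleO (Asymptotics.isLittleO_iff.2 fun ε hε => ?_)
  have hb : ∀ᶠ r in 𝓝 (u₀, v₀), ‖dY (dX f) r.1 r.2 - L‖ ≤ ε := by
    have := hc.eventually (Metric.closedBall_mem_nhds _ hε)
    filter_upwards [this] with r hr
    simpa [dist_eq_norm] using hr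
  obtain ⟨δ, hδ, H⟩ := Metric.eventually_nhds_iff_ball.1 (hx.and (hy.and (hxy.and hb)))
  have mem : ∀ {u v}, u ∈ Metric.ball u₀ δ → v ∈ Metric.ball v₀ δ →
      (u, v) ∈ Metric.ball (u₀, v₀) δ := by
    intro u v hu hv
    rw [← ball_prod_same]; exact ⟨hu, hv⟩
  have hu₀ : u₀ ∈ Metric.ball u₀ δ := Metric.mem_ball_self hδ
  have hv₀ : v₀ ∈ Metric.ball v₀ δ := Metric.mem_ball_self hδ
  filter_upwards [Metric.ball_mem_nhds u₀ hδ] with u hu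
  have hd : HasFDerivAt (fun v => f u v - f u₀ v - L.flip (u - u₀) v)
      (dY f u v₀ - dY f u₀ v₀ - L.flip (u - u₀)) v₀ :=
    (((H _ (mem hu hv₀)).2.1.hasFDerivAt).sub ((H _ (mem hu₀ hv₀)).2.1.hasFDerivAt)).sub
      (L.flip (u - u₀)).hasFDerivAt
  refine hd.le_of_lip' (by positivity) ?_
  filter_upwards [Metric.ball_mem_nhds v₀ hδ] with v hv
  -- the second difference of `f`, minus that of the bilinear map `L`, estimated through `∂_y ∂ₓ f`
  have key : ∀ u' ∈ Metric.ball u₀ δ, ‖dX f u' v - dX f u' v₀ - L (v - v₀)‖ ≤ ε * ‖v - v₀‖ := by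
    intro u' hu'
    exact (convex_ball v₀ δ).norm_image_sub_le_of_norm_fderiv_le' (𝕜 := ℝ) (f := dX f u') (φ := L)
      (fun w hw => (H _ (mem hu' hw)).2.2.1) (fun w hw => (H _ (mem hu' hw)).2.2.2) hv₀ hv
  have := (convex_ball u₀ δ).norm_image_sub_le_of_norm_hasFDerivWithin_le (𝕜 := ℝ)
    (f := fun u' => f u' v - f u' v₀ - L (v - v₀) u')
    (f' := fun u' => dX f u' v - dX f u' v₀ - L (v - v₀)) (C := ε * ‖v - v₀‖)
    (fun u' hu' => ((((H _ (mem hu' hv)).1.hasFDerivAt).sub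
      ((H _ (mem hu' hv₀)).1.hasFDerivAt)).sub (L (v - v₀)).hasFDerivAt).hasFDerivWithinAt)
    key hu₀ hu
  refine le_trans (le_of_eq ?_) (this.trans (le_of_eq (by ring)))
  congr 1
  simp only [map_sub, ContinuousLinearMap.flip_apply, sub_apply]
  abel

/-- Schwarz's theorem, applied twice: `∂ₓ ∂_y ∂_y g` exists and is a rearrangement of
`∂_y ∂_y ∂ₓ g`. -/
theorem hasFDerivAt_dY_dY {g : Model n → Model n → F} {S : Set (Model n × Model n)} (hS : IsOpen S)
    (hx : ∀ r ∈ S, DifferentiableAt ℝ (fun u => g u r.2) r.1)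
    (hy : ∀ r ∈ S, DifferentiableAt ℝ (fun v => g r.1 v) r.2)
    (hyy : ∀ r ∈ S, DifferentiableAt ℝ (fun v => dY g r.1 v) r.2)
    (hxy : ∀ r ∈ S, DifferentiableAt ℝ (fun v => dX g r.1 v) r.2)
    (hxyy : ∀ r ∈ S, DifferentiableAt ℝ (fun v => dY (dX g) r.1 v) r.2)
    (hc : ContinuousOn (fun r : Model n × Model n => dY (dX g) r.1 r.2) S)
    (hc' : ContinuousOn (fun r : Model n × Model n => dY (dY (dX g)) r.1 r.2) S)
    {q : Model n × Model n} (hq : q ∈ S) :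
    HasFDerivAt (fun u => dY (dY g) u q.2) (cycle (Model n) F (dY (dY (dX g)) q.1 q.2)) q.1 := by
  have ev : ∀ {r}, r ∈ S → S ∈ 𝓝 r := fun hr => hS.mem_nhds hr
  have h1 : ∀ r ∈ S, HasFDerivAt (fun u => dY g u r.2) (dY (dX g) r.1 r.2).flip r.1 := fun r hr =>
    hasFDerivAt_dY_of_dY_dX (mem_of_superset (ev hr) hx) (mem_of_superset (ev hr) hy)
      (mem_of_superset (ev hr) hxy) (hc.continuousAt (ev hr))
  have h2 : ∀ r ∈ S, HasFDerivAt (fun v => dX (dY g) r.1 v)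
      (transposeR (Model n) F (dY (dY (dX g)) r.1 r.2)) r.2 := by
    intro r hr
    have hd := hasFDerivAt_flip (hxyy r hr).hasFDerivAt
    refine hd.congr_of_eventuallyEq ?_
    have : ∀ᶠ v in 𝓝 r.2, (r.1, v) ∈ S :=
      (Continuous.prodMk_right r.1).continuousAt.preimage_mem_nhds (ev hr)
    filter_upwards [this] with v hv
    exact (h1 _ hv).fderiv
  have := hasFDerivAt_dY_of_dY_dX (f := dY g) (q := q)
    (mem_of_superset (ev hq) fun r hr => (h1 r hr).differentiableAt)
    (mem_of_superset (ev hq) hyy)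
    (mem_of_superset (ev hq) fun r hr => (h2 r hr).differentiableAt) ?_
  · have e : dY (dX (dY g)) q.1 q.2 = _ := (h2 q hq).fderiv
    rw [e] at this
    exact this
  · have hcc : ContinuousOn (fun r : Model n × Model n =>
        transposeR (Model n) F (dY (dY (dX g)) r.1 r.2)) S :=
      (transposeR (Model n) F).continuous.comp_continuousOn hc'
    exact (hcc.congr fun r hr => (h2 r hr).fderiv).continuousAt (ev hq)

end Schwarz

section Smooth

variable {n : ℕ}

/-- The mixed regularity of order `(2, 2)` on a set `S`: the derivatives of `f` of order at most two
in each variable exist (taken in the first variable first), and those involving both variables are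
continuous. -/
structure Mixed22On (S : Set (Model n × Model n)) (f : Model n → Model n → ℝ) : Prop where
  x₀ : ∀ q ∈ S, DifferentiableAt ℝ (fun u => f u q.2) q.1
  x₁ : ∀ q ∈ S, DifferentiableAt ℝ (fun u => dX f u q.2) q.1
  y₀ : ∀ q ∈ S, DifferentiableAt ℝ (fun v => f q.1 v) q.2
  yy₀ : ∀ q ∈ S, DifferentiableAt ℝ (fun v => dY f q.1 v) q.2
  y₁ : ∀ q ∈ S, DifferentiableAt ℝ (fun v => dX f q.1 v) q.2
  yy₁ : ∀ q ∈ S, DifferentiableAt ℝ (fun v => dY (dX f) q.1 v) q.2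
  y₂ : ∀ q ∈ S, DifferentiableAt ℝ (fun v => dX (dX f) q.1 v) q.2
  yy₂ : ∀ q ∈ S, DifferentiableAt ℝ (fun v => dY (dX (dX f)) q.1 v) q.2
  c₁₁ : ContinuousOn (fun r : Model n × Model n => dY (dX f) r.1 r.2) S
  c₁₂ : ContinuousOn (fun r : Model n × Model n => dY (dY (dX f)) r.1 r.2) S
  c₂₁ : ContinuousOn (fun r : Model n × Model n => dY (dX (dX f)) r.1 r.2) S
  c₂₂ : ContinuousOn (fun r : Model n × Model n => dY (dY (dX (dX f))) r.1 r.2) S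

/-- At a point of `S` the limit along `S` is the value of `g`. -/
theorem ExtendsTo.continuousOn {F : Type*} [NormedAddCommGroup F] {S T : Set (Model n × Model n)}
    {g : Model n → Model n → F} (h : ExtendsTo S T g) (hST : S ⊆ T) :
    ContinuousOn (fun r : Model n × Model n => g r.1 r.2) S := by
  intro q hq
  obtain ⟨l, hl⟩ := h q (hST hq)
  have : l = g q.1 q.2 :=
    tendsto_nhds_unique (hl.mono_left (pure_le_nhdsWithin hq)) (tendsto_pure_nhds _ q)
  rw [this] at hl
  exact hl

theorem MixedC22.mixed22On {S T : Set (Model n × Model n)} {f : Model n → Model n → ℝ}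
    (h : MixedC22 S T f) (hST : S ⊆ T) : Mixed22On S f := by
  obtain ⟨h1, h2, ⟨a1, a2, -, -, -⟩, ⟨b1, b2, -, b4, b5⟩, ⟨c1, c2, -, c4, c5⟩⟩ := h
  exact ⟨h1, h2, a1, a2, b1, b2, c1, c2, b4.continuousOn hST, b5.continuousOn hST,
    c4.continuousOn hST, c5.continuousOn hST⟩

namespace Mixed22On

variable {S : Set (Model n × Model n)} {f : Model n → Model n → ℝ}

theorem hasFDerivAt_dY (h : Mixed22On S f) (hS : IsOpen S) {q : Model n × Model n} (hq : q ∈ S) :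
    HasFDerivAt (fun u => dY f u q.2) (dY (dX f) q.1 q.2).flip q.1 :=
  hasFDerivAt_dY_of_dY_dX (mem_of_superset (hS.mem_nhds hq) h.x₀)
    (mem_of_superset (hS.mem_nhds hq) h.y₀) (mem_of_superset (hS.mem_nhds hq) h.y₁)
    (h.c₁₁.continuousAt (hS.mem_nhds hq))

theorem dX_dY (h : Mixed22On S f) (hS : IsOpen S) {q : Model n × Model n} (hq : q ∈ S) :
    dX (dY f) q.1 q.2 = (dY (dX f) q.1 q.2).flip :=
  (h.hasFDerivAt_dY hS hq).fderiv

theorem hasFDerivAt_dY_dY (h : Mixed22On S f) (hS : IsOpen S) {q : Model n × Model n}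
    (hq : q ∈ S) :
    HasFDerivAt (fun u => dY (dY f) u q.2) (cycle (Model n) ℝ (dY (dY (dX f)) q.1 q.2)) q.1 :=
  CConvexGeometry.hasFDerivAt_dY_dY hS h.x₀ h.y₀ h.yy₀ h.y₁ h.yy₁ h.c₁₁ h.c₁₂ hq

theorem dX_dY_dY (h : Mixed22On S f) (hS : IsOpen S) {q : Model n × Model n} (hq : q ∈ S) :
    dX (dY (dY f)) q.1 q.2 = cycle (Model n) ℝ (dY (dY (dX f)) q.1 q.2) :=
  (h.hasFDerivAt_dY_dY hS hq).fderiv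

theorem eventually_left (hS : IsOpen S) {q : Model n × Model n} (hq : q ∈ S) :
    ∀ᶠ u in 𝓝 q.1, (u, q.2) ∈ S :=
  (Continuous.prodMk_left q.2).continuousAt.preimage_mem_nhds (hS.mem_nhds hq)

theorem hasFDerivAt_dX_dY (h : Mixed22On S f) (hS : IsOpen S) {q : Model n × Model n}
    (hq : q ∈ S) :
    HasFDerivAt (fun u => dX (dY f) u q.2)
      (transposeR (Model n) ℝ (dY (dX (dX f)) q.1 q.2).flip) q.1 := by
  have h1 : HasFDerivAt (fun u => dY (dX f) u q.2) (dY (dX (dX f)) q.1 q.2).flip q.1 :=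
    hasFDerivAt_dY_of_dY_dX (mem_of_superset (hS.mem_nhds hq) h.x₁)
      (mem_of_superset (hS.mem_nhds hq) h.y₁) (mem_of_superset (hS.mem_nhds hq) h.y₂)
      (h.c₂₁.continuousAt (hS.mem_nhds hq))
  refine (hasFDerivAt_flip h1).congr_of_eventuallyEq ?_
  filter_upwards [eventually_left hS hq] with u hu
  exact h.dX_dY hS hu

theorem hasFDerivAt_dX_dY_dY (h : Mixed22On S f) (hS : IsOpen S) {q : Model n × Model n}
    (hq : q ∈ S) :
    HasFDerivAt (fun u => dX (dY (dY f)) u q.2)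
      (cycleR (Model n) ℝ (cycle (Model n) _ (dY (dY (dX (dX f))) q.1 q.2))) q.1 := by
  have h1 : HasFDerivAt (fun u => dY (dY (dX f)) u q.2)
      (cycle (Model n) _ (dY (dY (dX (dX f))) q.1 q.2)) q.1 :=
    CConvexGeometry.hasFDerivAt_dY_dY hS h.x₁ h.y₁ h.yy₁ h.y₂ h.yy₂ h.c₂₁ h.c₂₂ hq
  refine (hasFDerivAt_cycle h1).congr_of_eventuallyEq ?_
  filter_upwards [eventually_left hS hq] with u hu
  exact h.dX_dY_dY hS hu

theorem dX_dX_dY_apply (h : Mixed22On S f) (hS : IsOpen S) {q : Model n × Model n} (hq : q ∈ S)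
    (V W a : Model n) :
    dX (dX (dY f)) q.1 q.2 V W a = dY (dX (dX f)) q.1 q.2 a V W := by
  have e : dX (dX (dY f)) q.1 q.2 = _ := (h.hasFDerivAt_dX_dY hS hq).fderiv
  rw [e]; rfl

theorem dX_dX_dY_dY_apply (h : Mixed22On S f) (hS : IsOpen S) {q : Model n × Model n} (hq : q ∈ S)
    (V W a b : Model n) :
    dX (dX (dY (dY f))) q.1 q.2 V W a b = dY (dY (dX (dX f))) q.1 q.2 a b V W := by
  have e : dX (dX (dY (dY f))) q.1 q.2 = _ := (h.hasFDerivAt_dX_dY_dY hS hq).fderiv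
  rw [e]; rfl

/-- Mixed regularity is symmetric in the two variables. -/
theorem flip (h : Mixed22On S f) (hS : IsOpen S) : Mixed22On (Prod.swap ⁻¹' S) (flip f) where
  x₀ q hq := h.y₀ q.swap hq
  x₁ q hq := h.yy₀ q.swap hq
  y₀ q hq := h.x₀ q.swap hq
  yy₀ q hq := h.x₁ q.swap hq
  y₁ q hq := (h.hasFDerivAt_dY hS (q := q.swap) hq).differentiableAt
  yy₁ q hq := (h.hasFDerivAt_dX_dY hS (q := q.swap) hq).differentiableAt
  y₂ q hq := (h.hasFDerivAt_dY_dY hS (q := q.swap) hq).differentiableAt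
  yy₂ q hq := (h.hasFDerivAt_dX_dY_dY hS (q := q.swap) hq).differentiableAt
  c₁₁ := by
    have := (((transposeL (Model n) ℝ).continuous.comp_continuousOn h.c₁₁).congr
      fun r hr => h.dX_dY hS hr)
    exact this.comp continuous_swap.continuousOn fun r hr => hr
  c₁₂ := by
    have : ContinuousOn (fun r : Model n × Model n => dX (dX (dY f)) r.1 r.2) S :=
      ((transposeR (Model n) ℝ).continuous.comp_continuousOn
        ((transposeL (Model n) _).continuous.comp_continuousOn h.c₂₁)).congr
        fun r hr => (h.hasFDerivAt_dX_dY hS hr).fderiv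
    exact this.comp continuous_swap.continuousOn fun r hr => hr
  c₂₁ := by
    have : ContinuousOn (fun r : Model n × Model n => dX (dY (dY f)) r.1 r.2) S :=
      ((cycle (Model n) ℝ).continuous.comp_continuousOn h.c₁₂).congr fun r hr => h.dX_dY_dY hS hr
    exact this.comp continuous_swap.continuousOn fun r hr => hr
  c₂₂ := by
    have : ContinuousOn (fun r : Model n × Model n => dX (dX (dY (dY f))) r.1 r.2) S :=
      ((cycleR (Model n) ℝ).continuous.comp_continuousOn
        ((cycle (Model n) _).continuous.comp_continuousOn h.c₂₂)).congr
        fun r hr => (h.hasFDerivAt_dX_dY_dY hS hr).fderiv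
    exact this.comp continuous_swap.continuousOn fun r hr => hr

end Mixed22On

end Smooth

/-! ### The cross-curvature and bounds for it -/

section CrossCurvature

variable {n : ℕ}

/-- The Ma–Trudinger–Wang tensor with its covector arguments replaced by the corresponding vectors
`a = inv η`, `b = inv ζ`; in this form it is symmetric under the exchange of the two variables. -/
noncomputable def crossCurv (f : Model n → Model n → ℝ) (u v V W a b : Model n) : ℝ :=
  -(dY (dY (dX (dX f))) u v a b V W)
    + dY (dX (dX f)) u v ((dY (dX f) u v).inverse (dY (dY (dX f)) u v a b)) V W

theorem MTW_eq_crossCurv (f : Model n → Model n → ℝ) (u v V W : Model n)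
    (η ζ : Model n →L[ℝ] ℝ) :
    MTW f u v V W η ζ =
      crossCurv f u v V W ((dY (dX f) u v).inverse η) ((dY (dX f) u v).inverse ζ) := rfl

theorem apply_inverse_of_isInvertible {E F : Type*} [NormedAddCommGroup E] [NormedSpace ℝ E]
    [NormedAddCommGroup F] [NormedSpace ℝ F] {B : E →L[ℝ] F} (hB : B.IsInvertible) (y : F) :
    B (B.inverse y) = y := by
  obtain ⟨e, rfl⟩ := hB; simp

theorem inverse_apply_of_isInvertible {E F : Type*} [NormedAddCommGroup E] [NormedSpace ℝ E]
    [NormedAddCommGroup F] [NormedSpace ℝ F] {B : E →L[ℝ] F} (hB : B.IsInvertible) (x : E) :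
    B.inverse (B x) = x := by
  obtain ⟨e, rfl⟩ := hB; simp

theorem isInvertible_of_neg {E F : Type*} [NormedAddCommGroup E] [NormedSpace ℝ E]
    [NormedAddCommGroup F] [NormedSpace ℝ F] {B : E →L[ℝ] F} (hB : (-B).IsInvertible) :
    B.IsInvertible := by
  obtain ⟨e, he⟩ := hB
  refine ⟨e.trans (ContinuousLinearEquiv.neg ℝ), ?_⟩
  ext x
  have : e x = (-B) x := by rw [← he]; rfl
  simp [this]

/-- The transpose of an invertible pairing is invertible. -/
theorem isInvertible_flip {B : Model n →L[ℝ] Model n →L[ℝ] ℝ} (hB : B.IsInvertible) :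
    B.flip.IsInvertible := by
  have hinj : Function.Injective B.flip := by
    rw [injective_iff_map_eq_zero]
    intro V hV
    have h : ∀ η : Model n →L[ℝ] ℝ, η V = 0 := fun η => by
      have := congrArg (fun ξ : Model n →L[ℝ] ℝ => ξ (B.inverse η)) hV
      simpa [apply_inverse_of_isInvertible hB] using this
    have := h (innerSL ℝ V)
    simpa using this
  have hrank : Module.finrank ℝ (Model n) = Module.finrank ℝ (Model n →L[ℝ] ℝ) := by
    obtain ⟨e, -⟩ := hB
    exact e.toLinearEquiv.finrank_eq
  let e := LinearEquiv.ofInjectiveOfFinrankEq B.flip.toLinearMap hinj hrank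
  exact ⟨e.toContinuousLinearEquiv, by ext; rfl⟩

/-- The cross-curvature is symmetric under the exchange of the two variables. -/
theorem crossCurv_flip {S : Set (Model n × Model n)} {f : Model n → Model n → ℝ}
    (h : Mixed22On S f) (hS : IsOpen S) {q : Model n × Model n} (hq : q ∈ S)
    (hB : (dY (dX f) q.1 q.2).IsInvertible) (V W a b : Model n) :
    crossCurv (flip f) q.2 q.1 a b V W = crossCurv f q.1 q.2 V W a b := by
  have e1 : dY (dY (dX (dX (flip f)))) q.2 q.1 V W a b = dY (dY (dX (dX f))) q.1 q.2 a b V W :=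
    h.dX_dX_dY_dY_apply hS hq V W a b
  have e2 : ∀ z, dY (dX (dX (flip f))) q.2 q.1 z a b = dY (dY (dX f)) q.1 q.2 a b z := by
    intro z
    have : dY (dX (dX (flip f))) q.2 q.1 = _ := h.dX_dY_dY hS hq
    rw [this]; rfl
  have e3 : dY (dX (flip f)) q.2 q.1 = (dY (dX f) q.1 q.2).flip := h.dX_dY hS hq
  have e4 : ∀ z, dY (dY (dX (flip f))) q.2 q.1 V W z = dY (dX (dX f)) q.1 q.2 z V W :=
    fun z => h.dX_dX_dY_apply hS hq V W z
  unfold crossCurv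
  rw [e1, e2, e3]
  congr 1
  set B := dY (dX f) q.1 q.2
  set ξ := dY (dY (dX (flip f))) q.2 q.1 V W
  have : B.flip (B.flip.inverse ξ) = ξ := apply_inverse_of_isInvertible (isInvertible_flip hB) ξ
  rw [← e4]
  change _ = ξ _
  rw [← this, ContinuousLinearMap.flip_apply, apply_inverse_of_isInvertible hB, this]

theorem continuousOn_inverse {X : Type*} [TopologicalSpace X] {s : Set X}
    {B : X → Model n →L[ℝ] Model n →L[ℝ] ℝ} (hB : ContinuousOn B s)
    (hi : ∀ x ∈ s, (B x).IsInvertible) : ContinuousOn (fun x => (B x).inverse) s := by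
  intro x hx
  obtain ⟨e, he⟩ := hi x hx
  have : ContinuousAt (ContinuousLinearMap.inverse :
      (Model n →L[ℝ] Model n →L[ℝ] ℝ) → _) (B x) := by
    rw [← he]
    exact (contDiffAt_map_inverse (𝕜 := ℝ) (n := 0) e).continuousAt
  exact this.comp_continuousWithinAt (f := B) (hB x hx)

theorem continuousOn_crossCurv {S : Set (Model n × Model n)} {f : Model n → Model n → ℝ}
    (h : Mixed22On S f) (hB : ∀ q ∈ S, (dY (dX f) q.1 q.2).IsInvertible) (a b : Model n)
    {X : Type*} [TopologicalSpace X] {s : Set X} {q : X → Model n × Model n} {V W : X → Model n}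
    (hq : ContinuousOn q s) (hqS : MapsTo q s S) (hV : ContinuousOn V s)
    (hW : ContinuousOn W s) :
    ContinuousOn (fun x => crossCurv f (q x).1 (q x).2 (V x) (W x) a b) s := by
  have hc : ∀ {G : Type} [TopologicalSpace G] {g : Model n → Model n → G},
      ContinuousOn (fun r : Model n × Model n => g r.1 r.2) S →
      ContinuousOn (fun x => g (q x).1 (q x).2) s := fun hg => hg.comp hq hqS
  have h1 := ((((hc h.c₂₂).clm_apply (continuousOn_const (c := a))).clm_apply
    (continuousOn_const (c := b))).clm_apply hV).clm_apply hW
  have h2 := (continuousOn_inverse (hc h.c₁₁) (fun x hx => hB _ (hqS hx))).clm_apply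
    (((hc h.c₁₂).clm_apply (continuousOn_const (c := a))).clm_apply (continuousOn_const (c := b)))
  exact h1.neg.add ((((hc h.c₂₁).clm_apply h2).clm_apply hV).clm_apply hW)

theorem abs_crossCurv_le {f : Model n → Model n → ℝ} {u v : Model n} {A : ℝ} (hA : 0 ≤ A)
    (h22 : ‖dY (dY (dX (dX f))) u v‖ ≤ A) (h21 : ‖dY (dX (dX f)) u v‖ ≤ A)
    (h12 : ‖dY (dY (dX f)) u v‖ ≤ A) (hi : ‖(dY (dX f) u v).inverse‖ ≤ A)
    (V W a b : Model n) :
    |crossCurv f u v V W a b| ≤ (A + A * A * A) * (‖V‖ * ‖W‖ * ‖a‖ * ‖b‖) := by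
  have tri : ∀ {G : Type} [NormedAddCommGroup G] [NormedSpace ℝ G]
      (L : Model n →L[ℝ] Model n →L[ℝ] G) (_ : ‖L‖ ≤ A) (x y : Model n),
      ‖L x y‖ ≤ A * ‖x‖ * ‖y‖ := fun L hL x y => by
    refine (L.le_opNorm₂ x y).trans ?_
    gcongr
  have t1 : ‖dY (dY (dX (dX f))) u v a b V W‖ ≤ A * ‖a‖ * ‖b‖ * ‖V‖ * ‖W‖ := by
    refine (ContinuousLinearMap.le_opNorm₂ _ V W).trans ?_
    gcongr
    exact tri _ h22 a b
  set z := (dY (dX f) u v).inverse (dY (dY (dX f)) u v a b)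
  have hz : ‖z‖ ≤ A * (A * ‖a‖ * ‖b‖) := by
    refine (ContinuousLinearMap.le_opNorm _ _).trans ?_
    gcongr
    exact tri _ h12 a b
  have t2 : ‖dY (dX (dX f)) u v z V W‖ ≤ A * (A * (A * ‖a‖ * ‖b‖)) * ‖V‖ * ‖W‖ := by
    refine (ContinuousLinearMap.le_opNorm₂ _ V W).trans ?_
    gcongr
    exact (ContinuousLinearMap.le_opNorm _ _).trans (by gcongr)
  have := (abs_add_le (-(dY (dY (dX (dX f))) u v a b V W)) (dY (dX (dX f)) u v z V W)).trans
    (add_le_add ((abs_neg _).trans_le t1) t2)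
  refine this.trans (le_of_eq (by ring))

/-- Quantitative bounds on a cost at a point: its first derivatives, its mixed second derivative and
the inverse of that derivative, and its cross-curvature. -/
structure BoundAt (A : ℝ) (f : Model n → Model n → ℝ) (u v : Model n) : Prop where
  dX_le : ‖dX f u v‖ ≤ A
  dY_le : ‖dY f u v‖ ≤ A
  dYX_le : ‖dY (dX f) u v‖ ≤ A
  le_dYX : ∀ b, ‖b‖ ≤ A * ‖dY (dX f) u v b‖
  le_dYX_flip : ∀ V, ‖V‖ ≤ A * ‖(dY (dX f) u v).flip V‖
  cross_le : ∀ V W a b, |crossCurv f u v V W a b| ≤ A * (‖V‖ * ‖W‖ * ‖a‖ * ‖b‖)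

theorem BoundAt.mono {A A' : ℝ} {f : Model n → Model n → ℝ} {u v : Model n} (h : BoundAt A f u v)
    (hA : A ≤ A') : BoundAt A' f u v where
  dX_le := h.dX_le.trans hA
  dY_le := h.dY_le.trans hA
  dYX_le := h.dYX_le.trans hA
  le_dYX b := (h.le_dYX b).trans (by gcongr)
  le_dYX_flip b := (h.le_dYX_flip b).trans (by gcongr)
  cross_le V W a b := (h.cross_le V W a b).trans (by gcongr)

theorem BoundAt.flip {A : ℝ} {S : Set (Model n × Model n)} {f : Model n → Model n → ℝ}
    {q : Model n × Model n} (hb : BoundAt A f q.1 q.2) (h : Mixed22On S f) (hS : IsOpen S)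
    (hq : q ∈ S) (hB : (dY (dX f) q.1 q.2).IsInvertible) :
    BoundAt A (flip f) q.2 q.1 := by
  have e3 : dY (dX (_root_.flip f)) q.2 q.1 = (dY (dX f) q.1 q.2).flip := h.dX_dY hS hq
  refine ⟨hb.dY_le, hb.dX_le, ?_, ?_, ?_, ?_⟩
  · rw [e3, ContinuousLinearMap.opNorm_flip]; exact hb.dYX_le
  · rw [e3]; exact hb.le_dYX_flip
  · rw [e3]; exact hb.le_dYX
  · intro V W a b
    rw [crossCurv_flip h hS hq hB]
    exact (hb.cross_le a b V W).trans (le_of_eq (by ring))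

theorem BoundAt.of_norm_le {A : ℝ} {f : Model n → Model n → ℝ} {u v : Model n} (hA : 1 ≤ A)
    (hX : ‖dX f u v‖ ≤ A) (hY : ‖dY f u v‖ ≤ A) (h11 : ‖dY (dX f) u v‖ ≤ A)
    (h22 : ‖dY (dY (dX (dX f))) u v‖ ≤ A) (h21 : ‖dY (dX (dX f)) u v‖ ≤ A)
    (h12 : ‖dY (dY (dX f)) u v‖ ≤ A) (hi : ‖(dY (dX f) u v).inverse‖ ≤ A)
    (hB : (dY (dX f) u v).IsInvertible) : BoundAt (A + A * A * A) f u v := by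
  have hA0 : 0 ≤ A := by linarith
  have hle : A ≤ A + A * A * A := by
    have : 0 ≤ A * A * A := by positivity
    linarith
  refine ⟨hX.trans hle, hY.trans hle, h11.trans hle, fun b => ?_, fun V => ?_,
    abs_crossCurv_le hA0 h22 h21 h12 hi⟩
  · calc ‖b‖ = ‖(dY (dX f) u v).inverse (dY (dX f) u v b)‖ := by
          rw [inverse_apply_of_isInvertible hB]
      _ ≤ A * ‖dY (dX f) u v b‖ := (ContinuousLinearMap.le_opNorm _ _).trans (by gcongr)
      _ ≤ _ := by gcongr
  · -- test `V` against the covector `⟪V, ·⟫`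
    set B := dY (dX f) u v
    have h1 : ‖V‖ * ‖V‖ ≤ ‖B.flip V‖ * (A * ‖V‖) := by
      calc ‖V‖ * ‖V‖ = B (B.inverse (innerSL ℝ V)) V := by
            rw [apply_inverse_of_isInvertible hB]; simp [sq]
        _ = B.flip V (B.inverse (innerSL ℝ V)) := rfl
        _ ≤ ‖B.flip V‖ * ‖B.inverse (innerSL ℝ V)‖ :=
            (le_abs_self _).trans ((B.flip V).le_opNorm _)
        _ ≤ ‖B.flip V‖ * (A * ‖V‖) := by
            gcongr
            refine (ContinuousLinearMap.le_opNorm _ _).trans ?_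
            rw [innerSL_apply_norm]
            gcongr
    refine le_trans ?_ (mul_le_mul_of_nonneg_right hle (norm_nonneg _))
    rcases eq_or_lt_of_le (norm_nonneg V) with h0 | h0
    · rw [← h0]; positivity
    · refine le_of_mul_le_mul_right ?_ h0
      linarith

/-- A function with a continuous extension to `T` is bounded near any compact subset of `T`. -/
theorem ExtendsTo.exists_bound {F : Type*} [NormedAddCommGroup F] {S T C : Set (Model n × Model n)}
    {g : Model n → Model n → F} (h : ExtendsTo S T g) (hC : IsCompact C) (hCT : C ⊆ T) :
    ∃ A : ℝ, ∀ q ∈ S ∩ C, ‖g q.1 q.2‖ ≤ A := by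
  refine hC.induction_on (p := fun s => ∃ A : ℝ, ∀ q ∈ S ∩ s, ‖g q.1 q.2‖ ≤ A) ?_ ?_ ?_ ?_
  · exact ⟨0, by simp⟩
  · rintro s t hst ⟨A, hA⟩
    exact ⟨A, fun q hq => hA q ⟨hq.1, hst hq.2⟩⟩
  · rintro s t ⟨A, hA⟩ ⟨A', hA'⟩
    refine ⟨max A A', fun q hq => ?_⟩
    rcases hq.2 with h2 | h2
    · exact (hA q ⟨hq.1, h2⟩).trans (le_max_left _ _)
    · exact (hA' q ⟨hq.1, h2⟩).trans (le_max_right _ _)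
  · intro q hq
    obtain ⟨l, hl⟩ := h q (hCT hq)
    have := hl.norm.eventually_le_const (lt_add_one ‖l‖)
    obtain ⟨U, hU, hUS⟩ := mem_nhdsWithin_iff_exists_mem_nhds_inter.1 this
    exact ⟨U, mem_nhdsWithin_of_mem_nhds hU, ‖l‖ + 1, fun r hr => hUS ⟨hr.2, hr.1⟩⟩

theorem exists_boundAt {S T C : Set (Model n × Model n)} {f : Model n → Model n → ℝ}
    (h : MixedC22 S T f) (hC : IsCompact C) (hCT : C ⊆ T)
    (hB : ∀ q ∈ T, (extendFrom S (fun r : Model n × Model n => dY (dX f) r.1 r.2) q).IsInvertible)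
    (hBS : ∀ q ∈ S, (dY (dX f) q.1 q.2).IsInvertible) :
    ∃ A : ℝ, ∀ q ∈ S ∩ C, BoundAt A f q.1 q.2 := by
  obtain ⟨-, -, ⟨-, -, -, a4, -⟩, ⟨-, -, b3, b4, b5⟩, ⟨-, -, -, c4, c5⟩⟩ := h
  have hinv : ExtendsTo S T (fun u v => (dY (dX f) u v).inverse) := by
    intro q hq
    have hl := tendsto_extendFrom (b4 q hq)
    obtain ⟨e, he⟩ := hB q hq
    rw [← he] at hl
    exact ⟨_, (contDiffAt_map_inverse (𝕜 := ℝ) (n := 0) e).continuousAt.tendsto.comp hl⟩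
  obtain ⟨A1, h1⟩ := b3.exists_bound hC hCT
  obtain ⟨A2, h2⟩ := a4.exists_bound hC hCT
  obtain ⟨A3, h3⟩ := b4.exists_bound hC hCT
  obtain ⟨A4, h4⟩ := c5.exists_bound hC hCT
  obtain ⟨A5, h5⟩ := c4.exists_bound hC hCT
  obtain ⟨A6, h6⟩ := b5.exists_bound hC hCT
  obtain ⟨A7, h7⟩ := hinv.exists_bound hC hCT
  set A := 1 + |A1| + |A2| + |A3| + |A4| + |A5| + |A6| + |A7|
  have le : ∀ {x B : ℝ}, x ≤ B → |B| ≤ A → x ≤ A := fun h h' => (h.trans (le_abs_self _)).trans h'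
  refine ⟨A + A * A * A, fun q hq => BoundAt.of_norm_le ?_ (le (h1 q hq) ?_) (le (h2 q hq) ?_)
    (le (h3 q hq) ?_) (le (h4 q hq) ?_) (le (h5 q hq) ?_) (le (h6 q hq) ?_) (le (h7 q hq) ?_)
    (hBS q hq.1)⟩
  all_goals
    have := abs_nonneg A1; have := abs_nonneg A2; have := abs_nonneg A3; have := abs_nonneg A4
    have := abs_nonneg A5; have := abs_nonneg A6; have := abs_nonneg A7
    linarith

end CrossCurvature

/-! ### One-variable lemmas and curves with affine images -/

section OneVariable

/-- Taylor's formula of second order at a critical point, with the remainder at an unspecified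
point. -/
theorem exists_sub_eq_mul_of_deriv_eq_zero {Φ Φ₂ : ℝ → ℝ} {s : ℝ} (hs : 0 < s)
    (h1 : ∀ r ∈ Icc 0 s, DifferentiableAt ℝ Φ r)
    (h2 : ∀ r ∈ Icc 0 s, HasDerivAt (deriv Φ) (Φ₂ r) r) (h0 : deriv Φ 0 = 0) :
    ∃ ξ ∈ Ioo 0 s, ∃ ζ ∈ Ioo 0 ξ, Φ s - Φ 0 = s * ξ * Φ₂ ζ := by
  obtain ⟨ξ, hξ, e1⟩ := exists_hasDerivAt_eq_slope Φ (deriv Φ) hs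
    (fun r hr => (h1 r hr).continuousAt.continuousWithinAt)
    fun r hr => (h1 r (Ioo_subset_Icc_self hr)).hasDerivAt
  have sub : Icc 0 ξ ⊆ Icc 0 s := Icc_subset_Icc_right hξ.2.le
  obtain ⟨ζ, hζ, e2⟩ := exists_hasDerivAt_eq_slope (deriv Φ) Φ₂ hξ.1
    (fun r hr => (h2 r (sub hr)).continuousAt.continuousWithinAt)
    fun r hr => h2 r (sub (Ioo_subset_Icc_self hr))
  refine ⟨ξ, hξ, ζ, hζ, ?_⟩
  rw [h0, sub_zero, sub_zero, eq_div_iff hξ.1.ne'] at e2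
  rw [sub_zero, eq_div_iff hs.ne'] at e1
  rw [← e1, ← e2]; ring

/-- The differential inequality `f'' ≥ -C |f'|` implies quantitative quasiconvexity: where `f'` is
positive it cannot decay faster than exponentially, so that an initial increase of `f` is not lost
later. -/
theorem sub_le_of_neg_abs_deriv_le {f f₂ : ℝ → ℝ} {C : ℝ} (hC : 0 ≤ C)
    (h1 : ∀ t ∈ Icc (0 : ℝ) 1, DifferentiableAt ℝ f t)
    (h2 : ∀ t ∈ Icc (0 : ℝ) 1, HasDerivAt (deriv f) (f₂ t) t)
    (hf : ∀ t ∈ Icc (0 : ℝ) 1, -(C * |deriv f t|) ≤ f₂ t) {t : ℝ} (ht : t ∈ Icc (0 : ℝ) 1) :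
    f t - f 0 ≤ Real.exp (C + 1) * t * max (f 1 - f 0) 0 := by
  have hmax : 0 ≤ max (f 1 - f 0) 0 := le_max_right _ _
  rcases le_or_gt (f t) (f 0) with hle | hlt
  · have : 0 ≤ Real.exp (C + 1) * t * max (f 1 - f 0) 0 := by
      have := ht.1; positivity
    linarith
  have ht0 : 0 < t := by
    rcases eq_or_lt_of_le ht.1 with h | h
    · rw [← h] at hlt; exact absurd hlt (lt_irrefl _)
    · exact h
  obtain ⟨τ, hτ, e1⟩ := exists_hasDerivAt_eq_slope f (deriv f) ht0
    (fun r hr => (h1 r ⟨hr.1, hr.2.trans ht.2⟩).continuousAt.continuousWithinAt)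
    fun r hr => (h1 r ⟨hr.1.le, hr.2.le.trans ht.2⟩).hasDerivAt
  set m := deriv f τ with hm
  rw [sub_zero, eq_div_iff ht0.ne'] at e1
  have hm0 : 0 < m := by
    by_contra hcon
    have : m * t ≤ 0 := mul_nonpos_of_nonpos_of_nonneg (not_lt.1 hcon) ht0.le
    linarith
  -- comparison of `-f'` with the barrier `-m e^{-(C+1)(r-τ)}`, which solves `B' = -(C+1) B`
  have key : ∀ r ∈ Icc τ 1, m * Real.exp (-(C + 1) * (r - τ)) ≤ deriv f r := by
    have hsub : ∀ r ∈ Icc τ 1, r ∈ Icc (0 : ℝ) 1 := fun r hr => ⟨hτ.1.le.trans hr.1, hr.2⟩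
    have hB : ∀ r, HasDerivAt (fun r => -(m * Real.exp (-(C + 1) * (r - τ))))
        (-(m * (Real.exp (-(C + 1) * (r - τ)) * (-(C + 1) * 1)))) r := fun r =>
      (((((hasDerivAt_id r).sub_const τ).const_mul (-(C + 1))).exp).const_mul m).neg
    intro r hr
    have := image_le_of_deriv_right_lt_deriv_boundary (f := fun r => -deriv f r)
      (f' := fun r => -f₂ r) (a := τ) (b := 1)
      (fun r hr => (h2 r (hsub r hr)).continuousAt.continuousWithinAt.neg)
      (fun r hr => (h2 r (hsub r (Ico_subset_Icc_self hr))).neg.hasDerivWithinAt)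
      (B := fun r => -(m * Real.exp (-(C + 1) * (r - τ)))) (by simp [hm]) hB
      (fun r hr he => ?_) hr
    · simpa using this
    · have hpos : 0 < m * Real.exp (-(C + 1) * (r - τ)) := by positivity
      have he' : deriv f r = m * Real.exp (-(C + 1) * (r - τ)) := by simpa using he
      have := hf r (hsub r (Ico_subset_Icc_self hr))
      rw [he', abs_of_pos hpos] at this
      linarith
  have hexp : ∀ r ∈ Icc τ 1, m * Real.exp (-(C + 1)) ≤ deriv f r := by
    intro r hr
    refine le_trans ?_ (key r hr)
    gcongr
    have : 0 ≤ τ := hτ.1.le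
    nlinarith [hr.1, hr.2]
  have hle1 : Real.exp (-(C + 1)) ≤ 1 := Real.exp_le_one_iff.2 (by linarith)
  have h3 : (1 - t) * (m * Real.exp (-(C + 1))) ≤ f 1 - f t := by
    rcases eq_or_lt_of_le ht.2 with h | h
    · rw [h]; simp
    · obtain ⟨ρ, hρ, e3⟩ := exists_hasDerivAt_eq_slope f (deriv f) h
        (fun r hr => (h1 r ⟨ht0.le.trans hr.1, hr.2⟩).continuousAt.continuousWithinAt)
        fun r hr => (h1 r ⟨ht0.le.trans hr.1.le, hr.2.le⟩).hasDerivAt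
      have := hexp ρ ⟨hτ.2.le.trans hρ.1.le, hρ.2.le⟩
      rw [e3, le_div_iff₀ (by linarith)] at this
      linarith
  have h4 : m * Real.exp (-(C + 1)) ≤ f 1 - f 0 := by
    have : t * (m * Real.exp (-(C + 1))) ≤ t * m := by
      have := mul_le_mul_of_nonneg_left hle1 hm0.le
      rw [mul_one] at this
      gcongr
    linarith
  calc f t - f 0 = Real.exp (C + 1) * t * (m * Real.exp (-(C + 1))) := by
        rw [Real.exp_neg, ← e1]; field_simp
    _ ≤ _ := by
        refine mul_le_mul_of_nonneg_left (h4.trans (le_max_left _ _)) (by positivity)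

/-- The second derivative test, with a strict maximum. -/
theorem eventually_lt_of_deriv_deriv_neg {f : ℝ → ℝ} {l : ℝ} (hl : l < 0)
    (h1 : ∀ᶠ t in 𝓝 (0 : ℝ), DifferentiableAt ℝ f t) (h0 : deriv f 0 = 0)
    (h2 : HasDerivAt (deriv f) l 0) :
    ∀ᶠ t in 𝓝[>] (0 : ℝ), f t < f 0 ∧ f (-t) < f 0 := by
  have hs := hasDerivAt_iff_tendsto_slope.1 h2
  have hneg : ∀ᶠ t in 𝓝[≠] (0 : ℝ), slope (deriv f) 0 t < 0 := hs.eventually_lt_const hl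
  rw [eventually_nhdsWithin_iff] at hneg
  obtain ⟨δ, hδ, H⟩ := Metric.eventually_nhds_iff_ball.1 (h1.and hneg)
  have hslope : ∀ t, slope (deriv f) 0 t = deriv f t / t := fun t => by
    rw [slope_def_field, h0, sub_zero, sub_zero]
  filter_upwards [Ioo_mem_nhdsGT hδ] with t ht
  have hin : ∀ r ∈ Icc (-t) t, r ∈ Metric.ball (0 : ℝ) δ := fun r hr => by
    rw [Metric.mem_ball, dist_zero_right, Real.norm_eq_abs, abs_lt]
    constructor <;> linarith [hr.1, hr.2, ht.2]
  have hd : ∀ r ∈ Icc (-t) t, DifferentiableAt ℝ f r := fun r hr => (H r (hin r hr)).1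
  constructor
  · obtain ⟨ξ, hξ, e⟩ := exists_hasDerivAt_eq_slope f (deriv f) ht.1
      (fun r hr => (hd r ⟨by linarith [hr.1, ht.1], hr.2⟩).continuousAt.continuousWithinAt)
      fun r hr => (hd r ⟨by linarith [hr.1, ht.1], hr.2.le⟩).hasDerivAt
    have := (H ξ (hin ξ ⟨by linarith [hξ.1, ht.1], hξ.2.le⟩)).2 hξ.1.ne'
    rw [hslope, div_neg_iff] at this
    have hneg : deriv f ξ < 0 := by
      rcases this with h | h
      · linarith [h.2, hξ.1]
      · exact h.1
    rw [e, sub_zero, div_neg_iff] at hneg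
    rcases hneg with h | h
    · linarith [h.2, ht.1]
    · linarith [h.1]
  · have hlt : -t < 0 := by linarith [ht.1]
    obtain ⟨ξ, hξ, e⟩ := exists_hasDerivAt_eq_slope f (deriv f) hlt
      (fun r hr => (hd r ⟨hr.1, by linarith [hr.2, ht.1]⟩).continuousAt.continuousWithinAt)
      fun r hr => (hd r ⟨hr.1.le, by linarith [hr.2, ht.1]⟩).hasDerivAt
    have := (H ξ (hin ξ ⟨hξ.1.le, by linarith [hξ.2, ht.1]⟩)).2 hξ.2.ne
    rw [hslope, div_neg_iff] at this
    have hpos : 0 < deriv f ξ := by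
      rcases this with h | h
      · exact h.1
      · linarith [h.2, hξ.2]
    rw [e, zero_sub, neg_neg, div_pos_iff] at hpos
    rcases hpos with h | h
    · linarith [h.1]
    · linarith [h.2, ht.1]

end OneVariable

section Curves

variable {E : Type*} [NormedAddCommGroup E] [NormedSpace ℝ E] [CompleteSpace E]
  {F : Type*} [NormedAddCommGroup F] [NormedSpace ℝ F]

/-- A curve that a local diffeomorphism maps to a line is differentiable. -/
theorem hasDerivAt_of_comp_eq_affine {P : E → F} {P' : E →L[ℝ] F} {v : ℝ → E} {t₀ : ℝ} {p₀ p₁ : F}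
    (hP : HasStrictFDerivAt P P' (v t₀)) (hi : P'.IsInvertible) (hv : ContinuousAt v t₀)
    (h : ∀ᶠ t in 𝓝 t₀, P (v t) = p₀ + t • p₁) : HasDerivAt v (P'.inverse p₁) t₀ := by
  obtain ⟨e, rfl⟩ := hi
  have h1 := hP.to_localInverse.hasFDerivAt
  have h2 : HasDerivAt (fun t : ℝ => p₀ + t • p₁) p₁ t₀ := by
    simpa using ((hasDerivAt_id t₀).smul_const p₁).const_add p₀
  rw [h.self_of_nhds] at h1
  have h3 := h1.comp_hasDerivAt t₀ h2
  rw [ContinuousLinearMap.inverse_equiv]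
  refine h3.congr_of_eventuallyEq ?_
  filter_upwards [hv.eventually hP.eventually_left_inverse, h] with t ht ht'
  simp only [Function.comp_apply]
  rw [← ht', ht]

/-- The second derivative `w` of a curve whose velocity solves `B(v) v' = p₁`. -/
theorem exists_hasDerivAt_inverse_apply {B : E → E →L[ℝ] F} {B' : E →L[ℝ] E →L[ℝ] F} {v : ℝ → E}
    {t₀ : ℝ} {p₁ : F} {a : E} (hB : HasFDerivAt B B' (v t₀)) (hi : (B (v t₀)).IsInvertible)
    (hv : HasDerivAt v a t₀) (ha : (B (v t₀)).inverse p₁ = a) :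
    ∃ w, HasDerivAt (fun t => (B (v t)).inverse p₁) w t₀ ∧ B (v t₀) w + B' a a = 0 := by
  have hBv : HasDerivAt (fun t => B (v t)) (B' a) t₀ := hB.comp_hasDerivAt t₀ hv
  obtain ⟨e, he⟩ := hi
  have hinv : DifferentiableAt ℝ (ContinuousLinearMap.inverse : (E →L[ℝ] F) → F →L[ℝ] E)
      (B (v t₀)) := by
    rw [← he]
    exact (contDiffAt_map_inverse (𝕜 := ℝ) (n := 1) e).differentiableAt (by simp)
  have hd : DifferentiableAt ℝ (fun t => (B (v t)).inverse p₁) t₀ :=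
    (hinv.comp t₀ hBv.differentiableAt).clm_apply (differentiableAt_const p₁)
  refine ⟨_, hd.hasDerivAt, ?_⟩
  have hprod := hBv.clm_apply hd.hasDerivAt
  have hev : ∀ᶠ t in 𝓝 t₀, B (v t) ((B (v t)).inverse p₁) = p₁ := by
    have : range ((↑) : (E ≃L[ℝ] F) → E →L[ℝ] F) ∈ 𝓝 (B (v t₀)) := by
      rw [← he]; exact e.nhds
    filter_upwards [hBv.continuousAt this] with t ht
    exact apply_inverse_of_isInvertible ht _
  have hconst : HasDerivAt (fun t => B (v t) ((B (v t)).inverse p₁)) 0 t₀ :=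
    (hasDerivAt_const t₀ p₁).congr_of_eventuallyEq hev
  have := hprod.unique hconst
  rw [ha] at this
  rw [add_comm]
  exact this

end Curves

section

variable {n : ℕ}

theorem Mixed22On.hasStrictFDerivAt_dX {S : Set (Model n × Model n)} {f : Model n → Model n → ℝ}
    (h : Mixed22On S f) (hS : IsOpen S) {q : Model n × Model n} (hq : q ∈ S) :
    HasStrictFDerivAt (dX f q.1) (dY (dX f) q.1 q.2) q.2 := by
  have hS' : ∀ᶠ z in 𝓝 q.2, (q.1, z) ∈ S :=
    (Continuous.prodMk_right q.1).continuousAt.preimage_mem_nhds (hS.mem_nhds hq)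
  refine hasStrictFDerivAt_of_hasFDerivAt_of_continuousAt (f' := fun z => dY (dX f) q.1 z) ?_ ?_
  · filter_upwards [hS'] with z hz
    exact (h.y₁ _ hz).hasFDerivAt
  · exact (h.c₁₁.continuousAt (hS.mem_nhds hq)).comp (f := fun z => (q.1, z))
      (Continuous.prodMk_right q.1).continuousAt

/-- A curve `v` along which the covector `dX f u₀ (v t)` is affine is twice differentiable; its
velocity and acceleration are determined by the derivatives of `f`. -/
theorem Mixed22On.exists_hasDerivAt_curve {S : Set (Model n × Model n)} {f : Model n → Model n → ℝ}
    (h : Mixed22On S f) (hS : IsOpen S) (hB : ∀ q ∈ S, (dY (dX f) q.1 q.2).IsInvertible)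
    {u₀ : Model n} {v : ℝ → Model n} {t₀ : ℝ} {p₀ p₁ : Model n →L[ℝ] ℝ}
    (hmem : (u₀, v t₀) ∈ S) (hv : ∀ᶠ t in 𝓝 t₀, ContinuousAt v t)
    (hseg : ∀ᶠ t in 𝓝 t₀, dX f u₀ (v t) = p₀ + t • p₁) :
    ∃ w, (∀ᶠ t in 𝓝 t₀, HasDerivAt v ((dY (dX f) u₀ (v t)).inverse p₁) t) ∧
      HasDerivAt (fun t => (dY (dX f) u₀ (v t)).inverse p₁) w t₀ ∧
      dY (dX f) u₀ (v t₀) w + dY (dY (dX f)) u₀ (v t₀) ((dY (dX f) u₀ (v t₀)).inverse p₁)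
        ((dY (dX f) u₀ (v t₀)).inverse p₁) = 0 := by
  have h1 : ∀ᶠ t in 𝓝 t₀, HasDerivAt v ((dY (dX f) u₀ (v t)).inverse p₁) t := by
    have hS' : ∀ᶠ t in 𝓝 t₀, (u₀, v t) ∈ S :=
      (continuousAt_const.prodMk hv.self_of_nhds).preimage_mem_nhds (hS.mem_nhds hmem)
    filter_upwards [hS', hv, hseg.eventually_nhds] with t ht hvt hst
    exact hasDerivAt_of_comp_eq_affine (h.hasStrictFDerivAt_dX hS ht) (hB _ ht) hvt hst
  obtain ⟨w, hw1, hw2⟩ := exists_hasDerivAt_inverse_apply (B := dY (dX f) u₀)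
    (h.yy₁ _ hmem).hasFDerivAt (hB _ hmem) h1.self_of_nhds rfl
  exact ⟨w, h1, hw1, hw2⟩

end

/-! ### Costs read in charts -/

section Charts

variable {n : ℕ}
  {M : Type*} [TopologicalSpace M] {N : Type*} [TopologicalSpace N]

/-- The differential of `c` in its first variable at `(x, y)`, read in the chart `φ`. -/
noncomputable def covD (φ : OpenPartialHomeomorph M (Model n)) (c : M → N → ℝ) (x : M) (y : N) :
    Model n →L[ℝ] ℝ :=
  fderiv ℝ (fun u => c (φ.symm u) y) (φ x)

/-- The Hessian of `c` in its first variable at `(x, y)`, read in the chart `φ`. -/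
noncomputable def hessD (φ : OpenPartialHomeomorph M (Model n)) (c : M → N → ℝ) (x : M) (y : N) :
    Model n →L[ℝ] Model n →L[ℝ] ℝ :=
  fderiv ℝ (fderiv ℝ (fun u => c (φ.symm u) y)) (φ x)

theorem dX_localRep {φ : OpenPartialHomeomorph M (Model n)} {ψ : OpenPartialHomeomorph N (Model n)}
    (c : M → N → ℝ) (x : M) {y : N} (hy : y ∈ ψ.source) :
    dX (localRep c φ ψ) (φ x) (ψ y) = covD φ c x y := by
  simp only [dX, localRep, covD, ψ.left_inv hy]

theorem dY_localRep {φ : OpenPartialHomeomorph M (Model n)} {ψ : OpenPartialHomeomorph N (Model n)}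
    (c : M → N → ℝ) {x : M} (hx : x ∈ φ.source) (y : N) :
    dY (localRep c φ ψ) (φ x) (ψ y) = covD ψ (flip c) y x := by
  simp only [dY, localRep, covD, φ.left_inv hx, flip]

theorem dY_dY_localRep {φ : OpenPartialHomeomorph M (Model n)}
    {ψ : OpenPartialHomeomorph N (Model n)} (c : M → N → ℝ) {x : M} (hx : x ∈ φ.source) (y : N) :
    dY (dY (localRep c φ ψ)) (φ x) (ψ y) = hessD ψ (flip c) y x := by
  simp only [dY, localRep, hessD, φ.left_inv hx, flip]

theorem mem_chartProd {Ω : Set M} {Ω' : Set N} {φ : OpenPartialHomeomorph M (Model n)}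
    {ψ : OpenPartialHomeomorph N (Model n)} {x : M} {y : N} (hx : x ∈ Ω ∩ φ.source)
    (hy : y ∈ Ω' ∩ ψ.source) : (φ x, ψ y) ∈ chartProd Ω Ω' φ ψ :=
  ⟨mem_image_of_mem _ hx, mem_image_of_mem _ hy⟩

theorem isOpen_chartProd {Ω : Set M} {Ω' : Set N} (hΩ : IsOpen Ω) (hΩ' : IsOpen Ω')
    (φ : OpenPartialHomeomorph M (Model n)) (ψ : OpenPartialHomeomorph N (Model n)) :
    IsOpen (chartProd Ω Ω' φ ψ) := by
  refine IsOpen.prod ?_ ?_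
  · rw [inter_comm]; exact φ.isOpen_image_source_inter hΩ
  · rw [inter_comm]; exact ψ.isOpen_image_source_inter hΩ'

theorem chartProd_mono {A A' : Set M} {B B' : Set N} (hA : A ⊆ A') (hB : B ⊆ B')
    (φ : OpenPartialHomeomorph M (Model n)) (ψ : OpenPartialHomeomorph N (Model n)) :
    chartProd A B φ ψ ⊆ chartProd A' B' φ ψ :=
  prod_mono (image_mono (inter_subset_inter_left _ hA)) (image_mono (inter_subset_inter_left _ hB))

theorem chartProd_swap (Ω : Set M) (Ω' : Set N) (φ : OpenPartialHomeomorph M (Model n))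
    (ψ : OpenPartialHomeomorph N (Model n)) :
    Prod.swap ⁻¹' (chartProd Ω Ω' φ ψ) = chartProd Ω' Ω ψ φ := by
  ext q; exact And.comm

/-- The atlas of all smooth charts of `M`. -/
abbrev smoothAtlas (n : ℕ) (M : Type*) [TopologicalSpace M] [ChartedSpace (Model n) M] :
    Set (OpenPartialHomeomorph M (Model n)) :=
  IsManifold.maximalAtlas 𝓘(ℝ, Model n) ∞ M

end Charts

section SmoothCharts

variable {n : ℕ} {M : Type*} [TopologicalSpace M] [ChartedSpace (Model n) M] {N : Type*}

/-- The covectors `covD φ c x y` in two charts differ by a linear map that does not depend on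
`y`. -/
theorem covD_eq_comp {φ φ' : OpenPartialHomeomorph M (Model n)} (hφ : φ ∈ smoothAtlas n M)
    (hφ' : φ' ∈ smoothAtlas n M) {x : M} (hx : x ∈ φ.source) (hx' : x ∈ φ'.source)
    {c : M → N → ℝ} {y : N}
    (hd : DifferentiableAt ℝ (fun u => c (φ'.symm u) y) (φ' x)) :
    covD φ c x y = (covD φ' c x y).comp (fderiv ℝ (fun u => φ' (φ.symm u)) (φ x)) := by
  have hsrc : φ x ∈ (φ.symm.trans φ').source := by
    simp [φ.map_source hx, φ.left_inv hx, hx']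
  have htr : DifferentiableAt ℝ (fun u => φ' (φ.symm u)) (φ x) := by
    have h := (StructureGroupoid.compatible_of_mem_maximalAtlas hφ hφ')
    have h2 := (contDiffGroupoid ∞ 𝓘(ℝ, Model n)).mem_iff_of_eqOnSource (Setoid.refl _) |>.1 h
    rw [contDiffGroupoid, mem_groupoid_of_pregroupoid] at h2
    have h3 := h2.1
    have h4 : ContDiffOn ℝ ∞ (fun u => φ' (φ.symm u)) (φ.symm.trans φ').source := by
      simpa [contDiffPregroupoid, Function.comp_def] using h3
    exact (h4.contDiffAt ((φ.symm.trans φ').open_source.mem_nhds hsrc)).differentiableAt (by simp)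
  have hpt : φ' (φ.symm (φ x)) = φ' x := by rw [φ.left_inv hx]
  have hcomp := HasFDerivAt.comp (φ x) (g := fun u => c (φ'.symm u) y)
    (f := fun u => φ' (φ.symm u)) (by rw [hpt]; exact hd.hasFDerivAt) htr.hasFDerivAt
  refine (hcomp.congr_of_eventuallyEq ?_).fderiv
  filter_upwards [(φ.symm.trans φ').open_source.mem_nhds hsrc] with u hu
  simp only [Function.comp_apply]
  rw [φ'.left_inv (by simpa using hu.2)]

/-- Differentiability in the chart is needed: otherwise the manifold derivative in `negD` is `0` by
convention. -/
theorem negD_eq_neg_covD {c : M → N → ℝ} {x : M} {y : N}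
    (hd : DifferentiableAt ℝ (fun u => c ((chartAt (Model n) x).symm u) y)
      (chartAt (Model n) x x)) :
    negD n c x y = -(covD (chartAt (Model n) x) c x y : Model n →L[ℝ] ℝ) := by
  have hx := mem_chart_source (Model n) x
  have hc : ContinuousAt (fun x' => c x' y) x := by
    have h1 : ContinuousAt
        ((fun u => c ((chartAt (Model n) x).symm u) y) ∘ chartAt (Model n) x) x :=
      hd.continuousAt.comp ((chartAt (Model n) x).continuousAt hx)
    refine h1.congr ?_
    filter_upwards [(chartAt (Model n) x).open_source.mem_nhds hx] with x' hx'
    simp [(chartAt (Model n) x).left_inv hx']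
  have hm : HasMFDerivAt 𝓘(ℝ, Model n) 𝓘(ℝ, ℝ) (fun x' => c x' y) x
      (covD (chartAt (Model n) x) c x y) :=
    ⟨hc, hd.hasFDerivAt.hasFDerivWithinAt⟩
  exact congrArg (fun L : Model n →L[ℝ] ℝ => -L) hm.mfderiv

end SmoothCharts

/-! ### Regular costs and their `c`-segments -/

section Regular

variable {n : ℕ} {M : Type*} [TopologicalSpace M] [ChartedSpace (Model n) M]
  {N : Type*} [TopologicalSpace N] [ChartedSpace (Model n) N]

/-- The hypotheses on the cost in a form that is symmetric in the two variables and refers to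
interior points only. Compactness of the closures is replaced by `bound`: there are charts `k x`
around the points `x` of `Ω` and `k' y` around the points `y` of `Ω'` in which the cost has bounds
that are uniform in `(x, y)`. -/
structure RegularCost (n : ℕ) {M : Type*} [TopologicalSpace M] [ChartedSpace (Model n) M]
    {N : Type*} [TopologicalSpace N] [ChartedSpace (Model n) N]
    (c : M → N → ℝ) (Ω : Set M) (Ω' : Set N) : Prop where
  isOpen_left : IsOpen Ω
  isOpen_right : IsOpen Ω'
  mixed : ∀ φ ∈ smoothAtlas n M, ∀ ψ ∈ smoothAtlas n N,
    Mixed22On (chartProd Ω Ω' φ ψ) (localRep c φ ψ)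
  invertible : ∀ φ ∈ smoothAtlas n M, ∀ ψ ∈ smoothAtlas n N, ∀ q ∈ chartProd Ω Ω' φ ψ,
    (dY (dX (localRep c φ ψ)) q.1 q.2).IsInvertible
  twist : Twist n c Ω Ω'
  domConv : DomConv n c Ω Ω'
  bound : ∃ (A : ℝ) (k : M → OpenPartialHomeomorph M (Model n))
    (k' : N → OpenPartialHomeomorph N (Model n)),
    (∀ x ∈ Ω, k x ∈ smoothAtlas n M ∧ x ∈ (k x).source) ∧
    (∀ y ∈ Ω', k' y ∈ smoothAtlas n N ∧ y ∈ (k' y).source) ∧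
    ∀ x ∈ Ω, ∀ y ∈ Ω', BoundAt A (localRep c (k x) (k' y)) (k x x) (k' y y)

variable {c : M → N → ℝ} {Ω : Set M} {Ω' : Set N}

namespace RegularCost

theorem isOpen_prod (h : RegularCost n c Ω Ω') (φ : OpenPartialHomeomorph M (Model n))
    (ψ : OpenPartialHomeomorph N (Model n)) : IsOpen (chartProd Ω Ω' φ ψ) :=
  isOpen_chartProd h.isOpen_left h.isOpen_right φ ψ

theorem flip (h : RegularCost n c Ω Ω') : RegularCost n (flip c) Ω' Ω where
  isOpen_left := h.isOpen_right
  isOpen_right := h.isOpen_left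
  mixed φ hφ ψ hψ := by
    have := (h.mixed ψ hψ φ hφ).flip (h.isOpen_prod _ _)
    rwa [chartProd_swap] at this
  invertible φ hφ ψ hψ q hq := by
    have hq' : q.swap ∈ chartProd Ω Ω' ψ φ := hq.symm
    have e : dY (dX (localRep (_root_.flip c) φ ψ)) q.1 q.2 = _ :=
      (h.mixed ψ hψ φ hφ).dX_dY (h.isOpen_prod _ _) hq'
    rw [e]
    exact isInvertible_flip (h.invertible ψ hψ φ hφ _ hq')
  twist := h.twist.symm
  domConv := h.domConv.symm
  bound := by
    obtain ⟨A, k, k', hk, hk', hb⟩ := h.bound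
    refine ⟨A, k', k, hk', hk, fun y hy x hx => ?_⟩
    have hq := mem_chartProd ⟨hx, (hk x hx).2⟩ ⟨hy, (hk' y hy).2⟩
    exact BoundAt.flip (hb x hx y hy) (h.mixed _ (hk x hx).1 _ (hk' y hy).1) (h.isOpen_prod _ _) hq
      (h.invertible _ (hk x hx).1 _ (hk' y hy).1 _ hq)

end RegularCost

theorem exists_finset_charts (hcpt : IsCompact (closure Ω)) :
    ∃ (Z : Finset M) (K : M → Set M), (∀ z ∈ Z, IsCompact (K z) ∧ K z ⊆ closure Ω ∧
      K z ⊆ (chartAt (Model n) z).source) ∧ ∀ x ∈ closure Ω, ∃ z ∈ Z, x ∈ K z := by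
  have : LocallyCompactSpace M := ChartedSpace.locallyCompactSpace (Model n) M
  have h1 : ∀ z : M, ∃ L ∈ 𝓝 z, L ⊆ (chartAt (Model n) z).source ∧ IsCompact L := fun z =>
    local_compact_nhds (chart_source_mem_nhds (Model n) z)
  choose L hL hLs hLc using h1
  obtain ⟨Z, -, hZ⟩ := hcpt.elim_nhds_subcover L fun z _ => hL z
  refine ⟨Z, fun z => L z ∩ closure Ω, fun z _ => ⟨(hLc z).inter_right isClosed_closure,
    inter_subset_right, inter_subset_left.trans (hLs z)⟩, fun x hx => ?_⟩
  obtain ⟨z, hz, hxz⟩ := mem_iUnion₂.1 (hZ hx)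
  exact ⟨z, hz, hxz, hx⟩

/-- Uniform bounds come from finitely many charts with compact pieces that cover the closures of the
domains. -/
theorem regularCost_of_compact [IsManifold 𝓘(ℝ, Model n) ∞ M]
    [IsManifold 𝓘(ℝ, Model n) ∞ N] (hΩ : IsOpen Ω)
    (hΩ_cpt : IsCompact (closure Ω)) (hΩ' : IsOpen Ω') (hΩ'_cpt : IsCompact (closure Ω'))
    (hc : IsMixedC4 (n := n) c Ω Ω') (hTwist : Twist n c Ω Ω')
    (hNondeg : Nondeg (n := n) c Ω Ω') (hDomConv : DomConv n c Ω Ω') :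
    RegularCost n c Ω Ω' := by
  have hsub : ∀ (φ : OpenPartialHomeomorph M (Model n)) (ψ : OpenPartialHomeomorph N (Model n)),
      chartProd Ω Ω' φ ψ ⊆ chartProd (closure Ω) (closure Ω') φ ψ :=
    chartProd_mono subset_closure subset_closure
  have hmix : ∀ φ ∈ smoothAtlas n M, ∀ ψ ∈ smoothAtlas n N,
      Mixed22On (chartProd Ω Ω' φ ψ) (localRep c φ ψ) := fun φ hφ ψ hψ =>
    (hc φ hφ ψ hψ).mixed22On (hsub φ ψ)
  have hext : ∀ φ ∈ smoothAtlas n M, ∀ ψ ∈ smoothAtlas n N,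
      ∀ q ∈ chartProd (closure Ω) (closure Ω') φ ψ,
      (extendFrom (chartProd Ω Ω' φ ψ)
        (fun r : Model n × Model n => dY (dX (localRep c φ ψ)) r.1 r.2) q).IsInvertible :=
    fun φ hφ ψ hψ q hq => isInvertible_of_neg (hNondeg φ hφ ψ hψ q hq).1
  have hinv : ∀ φ ∈ smoothAtlas n M, ∀ ψ ∈ smoothAtlas n N, ∀ q ∈ chartProd Ω Ω' φ ψ,
      (dY (dX (localRep c φ ψ)) q.1 q.2).IsInvertible := by
    intro φ hφ ψ hψ q hq
    have h1 := hext φ hφ ψ hψ q (hsub φ ψ hq)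
    have h2 := extendFrom_eq (subset_closure hq)
      ((hmix φ hφ ψ hψ).c₁₁ q hq)
    rwa [h2] at h1
  refine ⟨hΩ, hΩ', hmix, hinv, hTwist, hDomConv, ?_⟩
  obtain ⟨Z, K, hK, hZ⟩ := exists_finset_charts (n := n) hΩ_cpt
  obtain ⟨Z', K', hK', hZ'⟩ := exists_finset_charts (n := n) hΩ'_cpt
  have hpair : ∀ z z', ∃ A : ℝ, z ∈ Z → z' ∈ Z' → ∀ x ∈ Ω ∩ K z, ∀ y ∈ Ω' ∩ K' z',
      BoundAt A (localRep c (chartAt (Model n) z) (chartAt (Model n) z'))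
        (chartAt (Model n) z x) (chartAt (Model n) z' y) := by
    intro z z'
    by_cases hz : z ∈ Z
    swap
    · exact ⟨0, fun h => absurd h hz⟩
    by_cases hz' : z' ∈ Z'
    swap
    · exact ⟨0, fun _ h => absurd h hz'⟩
    set φ := chartAt (Model n) z
    set ψ := chartAt (Model n) z'
    have hφ : φ ∈ smoothAtlas n M := IsManifold.chart_mem_maximalAtlas z
    have hψ : ψ ∈ smoothAtlas n N := IsManifold.chart_mem_maximalAtlas z'
    obtain ⟨k1, k2, k3⟩ := hK z hz
    obtain ⟨k1', k2', k3'⟩ := hK' z' hz'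
    have hC : IsCompact ((φ '' K z) ×ˢ (ψ '' K' z')) :=
      (k1.image_of_continuousOn (φ.continuousOn.mono k3)).prod
        (k1'.image_of_continuousOn (ψ.continuousOn.mono k3'))
    have hCT : (φ '' K z) ×ˢ (ψ '' K' z') ⊆ chartProd (closure Ω) (closure Ω') φ ψ :=
      prod_mono (image_mono (subset_inter k2 k3)) (image_mono (subset_inter k2' k3'))
    obtain ⟨A, hA⟩ := exists_boundAt (hc φ hφ ψ hψ) hC hCT (hext φ hφ ψ hψ) (hinv φ hφ ψ hψ)
    refine ⟨A, fun _ _ x hx y hy => hA (φ x, ψ y) ⟨?_, mem_image_of_mem _ hx.2,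
      mem_image_of_mem _ hy.2⟩⟩
    exact mem_chartProd ⟨hx.1, k3 hx.2⟩ ⟨hy.1, k3' hy.2⟩
  choose A hA using hpair
  choose! ζ hζ hxζ using hZ
  choose! ζ' hζ' hxζ' using hZ'
  refine ⟨∑ z ∈ Z, ∑ z' ∈ Z', |A z z'|, fun x => chartAt (Model n) (ζ x),
    fun y => chartAt (Model n) (ζ' y), fun x hx => ⟨IsManifold.chart_mem_maximalAtlas _,
      (hK _ (hζ x (subset_closure hx))).2.2 (hxζ x (subset_closure hx))⟩,
    fun y hy => ⟨IsManifold.chart_mem_maximalAtlas _,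
      (hK' _ (hζ' y (subset_closure hy))).2.2 (hxζ' y (subset_closure hy))⟩, fun x hx y hy => ?_⟩
  have hx' := subset_closure hx
  have hy' := subset_closure hy
  refine (hA (ζ x) (ζ' y) (hζ x hx') (hζ' y hy') x ⟨hx, hxζ x hx'⟩ y ⟨hy, hxζ' y hy'⟩).mono ?_
  calc A (ζ x) (ζ' y) ≤ |A (ζ x) (ζ' y)| := le_abs_self _
    _ ≤ ∑ z' ∈ Z', |A (ζ x) z'| :=
        Finset.single_le_sum (f := fun z' => |A (ζ x) z'|) (fun _ _ => abs_nonneg _) (hζ' y hy')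
    _ ≤ _ := Finset.single_le_sum (f := fun z => ∑ z' ∈ Z', |A z z'|)
        (fun _ _ => Finset.sum_nonneg fun _ _ => abs_nonneg _) (hζ x hx')

namespace RegularCost

theorem differentiableAt_chart [IsManifold 𝓘(ℝ, Model n) ∞ N]
    (h : RegularCost n c Ω Ω') {φ : OpenPartialHomeomorph M (Model n)} (hφ : φ ∈ smoothAtlas n M)
    {x : M} {y : N} (hx : x ∈ Ω) (hxφ : x ∈ φ.source) (hy : y ∈ Ω') :
    DifferentiableAt ℝ (fun u => c (φ.symm u) y) (φ x) := by
  have hys := mem_chart_source (Model n) y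
  have := (h.mixed φ hφ _ (IsManifold.chart_mem_maximalAtlas y)).x₀ _
    (mem_chartProd ⟨hx, hxφ⟩ ⟨hy, hys⟩)
  simpa [localRep, (chartAt (Model n) y).left_inv hys] using this

/-- In any chart, `covD` is the image of `negD` under a linear map that does not depend on `y`, and
conversely. -/
theorem exists_linear_covD [IsManifold 𝓘(ℝ, Model n) ∞ M] [IsManifold 𝓘(ℝ, Model n) ∞ N]
    (h : RegularCost n c Ω Ω') {φ : OpenPartialHomeomorph M (Model n)} (hφ : φ ∈ smoothAtlas n M)
    {x : M} (hx : x ∈ Ω) (hxφ : x ∈ φ.source) :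
    ∃ L L' : Model n →L[ℝ] Model n, ∀ y ∈ Ω',
      covD φ c x y = (show Model n →L[ℝ] ℝ from negD n c x y).comp L ∧
      (show Model n →L[ℝ] ℝ from negD n c x y) = (covD φ c x y).comp L' := by
  set φ' := chartAt (Model n) x
  have hφ' : φ' ∈ smoothAtlas n M := IsManifold.chart_mem_maximalAtlas x
  have hxφ' : x ∈ φ'.source := mem_chart_source _ x
  refine ⟨-fderiv ℝ (fun u => φ' (φ.symm u)) (φ x), -fderiv ℝ (fun u => φ (φ'.symm u)) (φ' x),
    fun y hy => ?_⟩
  have hd := h.differentiableAt_chart hφ hx hxφ hy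
  have hd' := h.differentiableAt_chart hφ' hx hxφ' hy
  have e : (show Model n →L[ℝ] ℝ from negD n c x y) = -covD φ' c x y := negD_eq_neg_covD hd'
  rw [e]
  constructor
  · rw [covD_eq_comp hφ hφ' hxφ hxφ' hd']; ext; simp
  · rw [covD_eq_comp hφ' hφ hxφ' hxφ hd]; ext; simp

theorem injOn_covD [IsManifold 𝓘(ℝ, Model n) ∞ M] [IsManifold 𝓘(ℝ, Model n) ∞ N]
    (h : RegularCost n c Ω Ω') {φ : OpenPartialHomeomorph M (Model n)} (hφ : φ ∈ smoothAtlas n M)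
    {x : M} (hx : x ∈ Ω) (hxφ : x ∈ φ.source) : InjOn (covD φ c x) Ω' := by
  obtain ⟨L, L', hL⟩ := h.exists_linear_covD hφ hx hxφ
  intro y hy y' hy' e
  refine h.twist.1 x hx hy hy' ?_
  change (show Model n →L[ℝ] ℝ from negD n c x y) = (show Model n →L[ℝ] ℝ from negD n c x y')
  rw [(hL y hy).2, (hL y' hy').2, e]

theorem isCSegment_iff [IsManifold 𝓘(ℝ, Model n) ∞ M] [IsManifold 𝓘(ℝ, Model n) ∞ N]
    (h : RegularCost n c Ω Ω') {φ : OpenPartialHomeomorph M (Model n)} (hφ : φ ∈ smoothAtlas n M)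
    {x : M} (hx : x ∈ Ω) (hxφ : x ∈ φ.source) {y₀ y₁ : N} (hy₀ : y₀ ∈ Ω') (hy₁ : y₁ ∈ Ω')
    {γ : ℝ → N} :
    IsCSegment n c Ω' x y₀ y₁ γ ↔ ∀ t ∈ Icc (0 : ℝ) 1, γ t ∈ Ω' ∧
      covD φ c x (γ t) = (1 - t) • covD φ c x y₀ + t • covD φ c x y₁ := by
  obtain ⟨L, L', hL⟩ := h.exists_linear_covD hφ hx hxφ
  refine forall₂_congr fun t _ => and_congr_right fun hγ => ?_
  change (show Model n →L[ℝ] ℝ from negD n c x (γ t)) =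
    (1 - t) • (show Model n →L[ℝ] ℝ from negD n c x y₀) +
      t • (show Model n →L[ℝ] ℝ from negD n c x y₁) ↔ _
  constructor
  · intro e
    rw [(hL _ hγ).1, e, (hL _ hy₀).1, (hL _ hy₁).1]; rfl
  · intro e
    rw [(hL _ hγ).2, e, (hL _ hy₀).2, (hL _ hy₁).2]; rfl

/-- `y ↦ covD φ c x y` is a local homeomorphism. -/
theorem map_nhds_covD [IsManifold 𝓘(ℝ, Model n) ∞ N]
    (h : RegularCost n c Ω Ω') {φ : OpenPartialHomeomorph M (Model n)} (hφ : φ ∈ smoothAtlas n M)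
    {x : M} (hx : x ∈ Ω) (hxφ : x ∈ φ.source) {y : N} (hy : y ∈ Ω') :
    map (covD φ c x) (𝓝 y) = 𝓝 (covD φ c x y) := by
  set ψ := chartAt (Model n) y
  have hψ : ψ ∈ smoothAtlas n N := IsManifold.chart_mem_maximalAtlas y
  have hyψ : y ∈ ψ.source := mem_chart_source _ y
  have hq := mem_chartProd (φ := φ) ⟨hx, hxφ⟩ ⟨hy, hyψ⟩
  have hstrict := (h.mixed φ hφ ψ hψ).hasStrictFDerivAt_dX (h.isOpen_prod φ ψ) hq
  obtain ⟨e, he⟩ := h.invertible φ hφ ψ hψ _ hq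
  rw [← he] at hstrict
  have h1 := hstrict.map_nhds_eq_of_equiv
  rw [← ψ.map_nhds_eq hyψ, map_map, dX_localRep c x hyψ] at h1
  rw [← h1]
  refine map_congr ?_
  filter_upwards [ψ.open_source.mem_nhds hyψ] with y' hy'
  exact (dX_localRep c x hy').symm

/-- The `c`-exponential map: the inverse `G` of `y ↦ covD φ c x y` is continuous on its open
domain. -/
theorem exists_cExp [IsManifold 𝓘(ℝ, Model n) ∞ M] [IsManifold 𝓘(ℝ, Model n) ∞ N]
    (h : RegularCost n c Ω Ω') {φ : OpenPartialHomeomorph M (Model n)} (hφ : φ ∈ smoothAtlas n M)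
    {x : M} (hx : x ∈ Ω) (hxφ : x ∈ φ.source) [Nonempty N] :
    IsOpen (covD φ c x '' Ω') ∧ ∃ G : (Model n →L[ℝ] ℝ) → N, ∀ y ∈ Ω',
      G (covD φ c x y) = y ∧ ContinuousAt G (covD φ c x y) := by
  have hinj := h.injOn_covD hφ hx hxφ
  refine ⟨isOpen_iff_mem_nhds.2 ?_, ?_⟩
  · rintro _ ⟨y, hy, rfl⟩
    rw [← h.map_nhds_covD hφ hx hxφ hy]
    exact image_mem_map (h.isOpen_right.mem_nhds hy)
  · refine ⟨Function.invFunOn (covD φ c x) Ω', fun y hy => ?_⟩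
    have hleft : LeftInvOn (Function.invFunOn (covD φ c x) Ω') (covD φ c x) Ω' :=
      hinj.leftInvOn_invFunOn
    refine ⟨hleft hy, ?_⟩
    rw [ContinuousAt, hleft hy, ← h.map_nhds_covD hφ hx hxφ hy, tendsto_map'_iff]
    refine tendsto_id.congr' ?_
    filter_upwards [h.isOpen_right.mem_nhds hy] with y' hy'
    exact (hleft hy').symm

end RegularCost

/-- `γ` is, on the open set `I` of parameters, a `c`-segment in `Ω'` with respect to `x`, with the
affine parametrization `t ↦ p₀ + t p₁` in the chart `φ`. -/
structure IsSegmentOn (φ : OpenPartialHomeomorph M (Model n)) (c : M → N → ℝ) (Ω' : Set N) (x : M)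
    (p₀ p₁ : Model n →L[ℝ] ℝ) (γ : ℝ → N) (I : Set ℝ) : Prop where
  isOpen : IsOpen I
  mem : ∀ t ∈ I, γ t ∈ Ω'
  continuousAt : ∀ t ∈ I, ContinuousAt γ t
  covD_eq : ∀ t ∈ I, covD φ c x (γ t) = p₀ + t • p₁

theorem RegularCost.exists_isSegmentOn [IsManifold 𝓘(ℝ, Model n) ∞ M]
    [IsManifold 𝓘(ℝ, Model n) ∞ N] (h : RegularCost n c Ω Ω')
    {φ : OpenPartialHomeomorph M (Model n)} (hφ : φ ∈ smoothAtlas n M)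
    {x : M} (hx : x ∈ Ω) (hxφ : x ∈ φ.source) [Nonempty N] (p₀ p₁ : Model n →L[ℝ] ℝ) :
    ∃ γ I, IsSegmentOn φ c Ω' x p₀ p₁ γ I ∧
      ∀ t, ∀ y ∈ Ω', covD φ c x y = p₀ + t • p₁ → t ∈ I ∧ γ t = y := by
  obtain ⟨ho, G, hG⟩ := h.exists_cExp hφ hx hxφ
  have hcont : Continuous fun t : ℝ => p₀ + t • p₁ := by fun_prop
  refine ⟨fun t => G (p₀ + t • p₁), (fun t : ℝ => p₀ + t • p₁) ⁻¹' (covD φ c x '' Ω'),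
    ⟨ho.preimage hcont, ?_, ?_, ?_⟩, ?_⟩
  · rintro t ⟨y, hy, e⟩
    have e : covD φ c x y = p₀ + t • p₁ := e
    rw [← e, (hG y hy).1]; exact hy
  · rintro t ⟨y, hy, e⟩
    have := (hG y hy).2
    rw [e] at this
    exact this.comp (f := fun t : ℝ => p₀ + t • p₁) hcont.continuousAt
  · rintro t ⟨y, hy, e⟩
    have e : covD φ c x y = p₀ + t • p₁ := e
    rw [← e, (hG y hy).1]
  · intro t y hy e
    exact ⟨⟨y, hy, e⟩, by simp only; rw [← e, (hG y hy).1]⟩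

end Regular

/-! ### Derivatives along `c`-segments -/

section SecondVariation

variable {n : ℕ} {M : Type*} [TopologicalSpace M] [ChartedSpace (Model n) M]
  {N : Type*} [TopologicalSpace N] [ChartedSpace (Model n) N]
  {c : M → N → ℝ} {Ω : Set M} {Ω' : Set N}

/-- A `c`-segment, read in a chart, is twice differentiable. -/
theorem IsSegmentOn.exists_hasDerivAt (h : RegularCost n c Ω Ω')
    {φ : OpenPartialHomeomorph M (Model n)} (hφ : φ ∈ smoothAtlas n M)
    {x : M} (hx : x ∈ Ω) (hxφ : x ∈ φ.source)
    {p₀ p₁ : Model n →L[ℝ] ℝ} {γ : ℝ → N} {I : Set ℝ} (hγ : IsSegmentOn φ c Ω' x p₀ p₁ γ I)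
    {t₀ : ℝ} (ht₀ : t₀ ∈ I) {ψ : OpenPartialHomeomorph N (Model n)} (hψ : ψ ∈ smoothAtlas n N)
    (hψt : γ t₀ ∈ ψ.source) :
    ∃ w, (∀ᶠ t in 𝓝 t₀, HasDerivAt (fun t => ψ (γ t))
        ((dY (dX (localRep c φ ψ)) (φ x) (ψ (γ t))).inverse p₁) t) ∧
      HasDerivAt (fun t => (dY (dX (localRep c φ ψ)) (φ x) (ψ (γ t))).inverse p₁) w t₀ ∧
      dY (dX (localRep c φ ψ)) (φ x) (ψ (γ t₀)) w +
        dY (dY (dX (localRep c φ ψ))) (φ x) (ψ (γ t₀))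
          ((dY (dX (localRep c φ ψ)) (φ x) (ψ (γ t₀))).inverse p₁)
          ((dY (dX (localRep c φ ψ)) (φ x) (ψ (γ t₀))).inverse p₁) = 0 := by
  have hsrc : ∀ᶠ t in 𝓝 t₀, t ∈ I ∧ γ t ∈ ψ.source :=
    (hγ.isOpen.eventually_mem ht₀).and
      ((hγ.continuousAt t₀ ht₀).preimage_mem_nhds (ψ.open_source.mem_nhds hψt))
  refine (h.mixed φ hφ ψ hψ).exists_hasDerivAt_curve (h.isOpen_prod φ ψ) (h.invertible φ hφ ψ hψ)
    (v := fun t => ψ (γ t)) (p₀ := p₀) (mem_chartProd ⟨hx, hxφ⟩ ⟨hγ.mem _ ht₀, hψt⟩) ?_ ?_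
  · filter_upwards [hsrc] with t ht
    exact (ψ.continuousAt ht.2).comp (hγ.continuousAt t ht.1)
  · filter_upwards [hsrc] with t ht
    rw [dX_localRep c x ht.2]
    exact hγ.covD_eq t ht.1

/-- First and second derivative of a function `t ↦ c(x', γ t)` along a `c`-segment `γ` with respect
to another point `x`; the vectors `a` (velocity) and `w` (acceleration) do not depend on `x'`. -/
theorem IsSegmentOn.exists_deriv_cost [IsManifold 𝓘(ℝ, Model n) ∞ M] (h : RegularCost n c Ω Ω')
    {φ : OpenPartialHomeomorph M (Model n)} (hφ : φ ∈ smoothAtlas n M)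
    {x : M} (hx : x ∈ Ω) (hxφ : x ∈ φ.source)
    {p₀ p₁ : Model n →L[ℝ] ℝ} {γ : ℝ → N} {I : Set ℝ} (hγ : IsSegmentOn φ c Ω' x p₀ p₁ γ I)
    {t₀ : ℝ} (ht₀ : t₀ ∈ I) {ψ : OpenPartialHomeomorph N (Model n)} (hψ : ψ ∈ smoothAtlas n N)
    (hψt : γ t₀ ∈ ψ.source) :
    ∃ a w, dY (dX (localRep c φ ψ)) (φ x) (ψ (γ t₀)) a = p₁ ∧
      dY (dX (localRep c φ ψ)) (φ x) (ψ (γ t₀)) w +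
        dY (dY (dX (localRep c φ ψ))) (φ x) (ψ (γ t₀)) a a = 0 ∧
      ∀ x' ∈ Ω, HasDerivAt (fun t => c x' (γ t)) (covD ψ (flip c) (γ t₀) x' a) t₀ ∧
        HasDerivAt (deriv fun t => c x' (γ t))
          (hessD ψ (flip c) (γ t₀) x' a a + covD ψ (flip c) (γ t₀) x' w) t₀ := by
  obtain ⟨w, h1, h2, h3⟩ := hγ.exists_hasDerivAt h hφ hx hxφ ht₀ hψ hψt
  set a := (dY (dX (localRep c φ ψ)) (φ x) (ψ (γ t₀))).inverse p₁ with ha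
  refine ⟨a, w, ?_, h3, fun x' hx' => ?_⟩
  · exact apply_inverse_of_isInvertible (h.invertible φ hφ ψ hψ _
      (mem_chartProd ⟨hx, hxφ⟩ ⟨hγ.mem _ ht₀, hψt⟩)) _
  set φ' := chartAt (Model n) x'
  have hφ' : φ' ∈ smoothAtlas n M := IsManifold.chart_mem_maximalAtlas x'
  have hx'φ : x' ∈ φ'.source := mem_chart_source _ x'
  have hm := h.mixed φ' hφ' ψ hψ
  have hsrc : ∀ᶠ t in 𝓝 t₀, t ∈ I ∧ γ t ∈ ψ.source :=
    (hγ.isOpen.eventually_mem ht₀).and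
      ((hγ.continuousAt t₀ ht₀).preimage_mem_nhds (ψ.open_source.mem_nhds hψt))
  have hd : ∀ᶠ t in 𝓝 t₀, HasDerivAt (fun t => c x' (γ t))
      (dY (localRep c φ' ψ) (φ' x') (ψ (γ t))
        ((dY (dX (localRep c φ ψ)) (φ x) (ψ (γ t))).inverse p₁)) t := by
    filter_upwards [h1, hsrc, hsrc.eventually_nhds] with t ht hts htn
    have hq := mem_chartProd (φ := φ') ⟨hx', hx'φ⟩ ⟨hγ.mem t hts.1, hts.2⟩
    have := ((hm.y₀ _ hq).hasFDerivAt).comp_hasDerivAt t ht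
    refine this.congr_of_eventuallyEq ?_
    filter_upwards [htn] with r hr
    simp [localRep, φ'.left_inv hx'φ, ψ.left_inv hr.2]
  have hq := mem_chartProd (φ := φ') ⟨hx', hx'φ⟩ ⟨hγ.mem t₀ ht₀, hψt⟩
  constructor
  · have := hd.self_of_nhds
    rwa [dY_localRep c hx'φ] at this
  · have hyy := ((hm.yy₀ _ hq).hasFDerivAt).comp_hasDerivAt t₀ h1.self_of_nhds
    have := HasDerivAt.clm_apply hyy h2
    have e : dY (dY (localRep c φ' ψ)) (φ' x') (ψ (γ t₀)) = hessD ψ (flip c) (γ t₀) x' :=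
      dY_dY_localRep c hx'φ _
    have e' : dY (localRep c φ' ψ) (φ' x') (ψ (γ t₀)) = covD ψ (flip c) (γ t₀) x' :=
      dY_localRep c hx'φ _
    rw [← e, ← e']
    refine this.congr_of_eventuallyEq ?_
    filter_upwards [hd] with t ht
    exact ht.deriv

set_option maxHeartbeats 1000000 in
/-- The second variation along `c`-segments in both variables. Let `σ` be a `c`-segment with respect
to `y`, and consider `Φ(s) = D²c(σ s, y)(a, a) + Dc(σ s, y) w`, with the derivatives in the second
variable. The second term is affine in `s`, and the second derivative of `Φ` is minus the
cross-curvature. -/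
theorem IsSegmentOn.exists_deriv_hess (h : RegularCost n c Ω Ω')
    {ψ : OpenPartialHomeomorph N (Model n)} (hψ : ψ ∈ smoothAtlas n N)
    {y : N} (hy : y ∈ Ω') (hyψ : y ∈ ψ.source)
    {q₀ q₁ : Model n →L[ℝ] ℝ} {σ : ℝ → M} {J : Set ℝ}
    (hσ : IsSegmentOn ψ (flip c) Ω y q₀ q₁ σ J) (a w : Model n)
    {s₀ : ℝ} (hs₀ : s₀ ∈ J) {φ : OpenPartialHomeomorph M (Model n)} (hφ : φ ∈ smoothAtlas n M)
    (hφs : σ s₀ ∈ φ.source) :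
    ∃ V, (dY (dX (localRep c φ ψ)) (φ (σ s₀)) (ψ y)).flip V = q₁ ∧
      HasDerivAt (fun s => hessD ψ (flip c) y (σ s) a a + covD ψ (flip c) y (σ s) w)
        (dY (dY (dX (localRep c φ ψ))) (φ (σ s₀)) (ψ y) a a V + q₁ w) s₀ ∧
      HasDerivAt (deriv fun s => hessD ψ (flip c) y (σ s) a a + covD ψ (flip c) y (σ s) w)
        (-crossCurv (localRep c φ ψ) (φ (σ s₀)) (ψ y) V V a a) s₀ := by
  obtain ⟨u₂, h1, h2, h3⟩ := hσ.exists_hasDerivAt h.flip hψ hy hyψ hs₀ hφ hφs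
  have hm := h.mixed φ hφ ψ hψ
  have ho := h.isOpen_prod φ ψ
  have hq := mem_chartProd (ψ := ψ) ⟨hσ.mem s₀ hs₀, hφs⟩ ⟨hy, hyψ⟩
  have hB := h.invertible φ hφ ψ hψ _ hq
  set f := localRep c φ ψ with hf
  have hfl : localRep (flip c) ψ φ = flip f := rfl
  rw [hfl] at h1 h2 h3
  set V := (dY (dX (flip f)) (ψ y) (φ (σ s₀))).inverse q₁ with hV
  have e3 : dY (dX (flip f)) (ψ y) (φ (σ s₀)) = (dY (dX f) (φ (σ s₀)) (ψ y)).flip :=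
    hm.dX_dY ho hq
  have e4 : ∀ z, dY (dY (dX (flip f))) (ψ y) (φ (σ s₀)) V V z =
      dY (dX (dX f)) (φ (σ s₀)) (ψ y) z V V :=
    fun z => hm.dX_dX_dY_apply ho hq V V z
  have hsrc : ∀ᶠ s in 𝓝 s₀, s ∈ J ∧ σ s ∈ φ.source :=
    (hσ.isOpen.eventually_mem hs₀).and
      ((hσ.continuousAt s₀ hs₀).preimage_mem_nhds (φ.open_source.mem_nhds hφs))
  set Φ := fun s => hessD ψ (flip c) y (σ s) a a + covD ψ (flip c) y (σ s) w with hΦ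
  have hΦeq : ∀ s, s ∈ J ∧ σ s ∈ φ.source →
      Φ s = dY (dY f) (φ (σ s)) (ψ y) a a + (q₀ w + s * q₁ w) := by
    intro s hs
    simp only [hΦ]
    rw [hσ.covD_eq s hs.1, hf, dY_dY_localRep c hs.2 y]
    simp
  have hd : ∀ᶠ s in 𝓝 s₀, HasDerivAt Φ
      (dX (dY (dY f)) (φ (σ s)) (ψ y) ((dY (dX (flip f)) (ψ y) (φ (σ s))).inverse q₁) a a + q₁ w)
        s := by
    filter_upwards [h1, hsrc, hsrc.eventually_nhds] with s hs hss hsn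
    have hqs := mem_chartProd (ψ := ψ) ⟨hσ.mem s hss.1, hss.2⟩ ⟨hy, hyψ⟩
    have hd1 := (hm.hasFDerivAt_dY_dY ho hqs).comp_hasDerivAt s hs
    rw [← hm.dX_dY_dY ho hqs] at hd1
    have hd2 := (hd1.clm_apply (hasDerivAt_const s a)).clm_apply (hasDerivAt_const s a)
    have hd3 : HasDerivAt (fun s => q₀ w + s * q₁ w) (q₁ w) s := by
      simpa using ((hasDerivAt_id s).mul_const (q₁ w)).const_add (q₀ w)
    have hd4 := hd2.add hd3
    simp only [map_zero, add_zero] at hd4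
    refine hd4.congr_of_eventuallyEq ?_
    filter_upwards [hsn] with r hr
    exact hΦeq r hr
  refine ⟨V, ?_, ?_, ?_⟩
  · rw [hV, e3]
    exact apply_inverse_of_isInvertible (isInvertible_flip hB) _
  · have := hd.self_of_nhds
    have e : dX (dY (dY f)) (φ (σ s₀)) (ψ y) = _ := hm.dX_dY_dY ho hq
    rw [e] at this
    exact this
  · have hd1 := (hm.hasFDerivAt_dX_dY_dY ho hq).comp_hasDerivAt s₀ h1.self_of_nhds
    have hd2 := ((hd1.clm_apply h2).clm_apply (hasDerivAt_const s₀ a)).clm_apply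
      (hasDerivAt_const s₀ a)
    have hd3 := hd2.add_const (q₁ w)
    simp only [map_zero, add_zero] at hd3
    have heq : deriv Φ =ᶠ[𝓝 s₀] fun s => dX (dY (dY f)) (φ (σ s)) (ψ y)
        ((dY (dX (flip f)) (ψ y) (φ (σ s))).inverse q₁) a a + q₁ w := by
      filter_upwards [hd] with s hs
      exact hs.deriv
    have hd4 := hd3.congr_of_eventuallyEq heq
    refine hd4.congr_deriv ?_
    -- the acceleration of `σ` produces the second term of the cross-curvature
    set B := dY (dX f) (φ (σ s₀)) (ψ y)
    set ξ := dY (dY (dX f)) (φ (σ s₀)) (ψ y) a a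
    have hξ : B.flip u₂ (B.inverse ξ) + dY (dX (dX f)) (φ (σ s₀)) (ψ y) (B.inverse ξ) V V = 0 := by
      have := congrArg (fun L : Model n →L[ℝ] ℝ => L (B.inverse ξ)) h3
      rw [e3] at this
      rw [← e4]
      exact this
    have hξ' : B.flip u₂ (B.inverse ξ) = ξ u₂ := by
      rw [ContinuousLinearMap.flip_apply, apply_inverse_of_isInvertible hB]
    have e5 : dX (dY (dY f)) (φ (σ s₀)) (ψ y) u₂ a a = ξ u₂ := by
      have e : dX (dY (dY f)) (φ (σ s₀)) (ψ y) = _ := hm.dX_dY_dY ho hq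
      rw [e]; rfl
    have e6 : cycleR (Model n) ℝ (cycle (Model n) (Model n →L[ℝ] ℝ)
        (dY (dY (dX (dX f))) (φ (σ s₀)) (ψ y))) V V a a =
        dY (dY (dX (dX f))) (φ (σ s₀)) (ψ y) a a V V := rfl
    have e7 : crossCurv f (φ (σ s₀)) (ψ y) V V a a =
        -(dY (dY (dX (dX f))) (φ (σ s₀)) (ψ y) a a V V) +
          dY (dX (dX f)) (φ (σ s₀)) (ψ y) (B.inverse ξ) V V := rfl
    rw [e7]
    simp only [Function.comp_apply, add_apply]
    rw [e5]
    change cycleR (Model n) ℝ (cycle (Model n) (Model n →L[ℝ] ℝ)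
        (dY (dY (dX (dX f))) (φ (σ s₀)) (ψ y))) V V a a + _ = _
    rw [e6]
    linarith

end SecondVariation

/-! ### Cross-curvature and quasiconvexity -/

section Nonneg

variable {n : ℕ}

/-- Nonnegativity of the cross-curvature on null vectors of the pairing `∂_y ∂ₓ f` implies a lower
bound for arbitrary vectors, by a correction of `a` that makes `(V, a)` null. -/
theorem BoundAt.neg_le_crossCurv {A : ℝ} {f : Model n → Model n → ℝ} {u v : Model n}
    (hb : BoundAt A f u v) (hB : (dY (dX f) u v).IsInvertible)
    (hnn : ∀ V a, dY (dX f) u v a V = 0 → 0 ≤ crossCurv f u v V V a a) (V a : Model n) :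
    -(A ^ 2 * (2 + A ^ 2) * ‖V‖ * ‖a‖ * |dY (dX f) u v a V|) ≤ crossCurv f u v V V a a := by
  have hA : 0 ≤ A := (norm_nonneg _).trans hb.dX_le
  rcases eq_or_ne V 0 with rfl | hV
  · simp [crossCurv]
  set B := dY (dX f) u v with hBdef
  have hV0 : 0 < ‖V‖ := norm_pos_iff.2 hV
  set lam := B a V / ‖V‖ ^ 2 with hlam
  set b := B.inverse (lam • innerSL ℝ V) with hbdef
  have hBb : B b = lam • innerSL ℝ V := apply_inverse_of_isInvertible hB _
  have hnull : B (a - b) V = 0 := by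
    rw [map_sub, hBb]
    simp only [sub_apply, smul_apply, innerSL_apply_apply, real_inner_self_eq_norm_sq, smul_eq_mul,
      hlam]
    field_simp
    ring
  have hnorm : ‖B b‖ * ‖V‖ = |B a V| := by
    rw [hBb, norm_smul, innerSL_apply_norm, hlam, Real.norm_eq_abs, abs_div, abs_of_pos
      (by positivity : 0 < ‖V‖ ^ 2)]
    field_simp
  have hb1 : ‖b‖ * ‖V‖ ≤ A * |B a V| := by
    rw [← hnorm, ← mul_assoc]
    exact mul_le_mul_of_nonneg_right (hb.le_dYX b) hV0.le
  have hb2 : ‖b‖ ≤ A ^ 2 * ‖a‖ := by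
    have h1 : |B a V| ≤ A * ‖a‖ * ‖V‖ :=
      (B.le_opNorm₂ a V).trans (by gcongr; exact hb.dYX_le)
    have h2 : ‖b‖ * ‖V‖ ≤ A ^ 2 * ‖a‖ * ‖V‖ :=
      hb1.trans ((mul_le_mul_of_nonneg_left h1 hA).trans (le_of_eq (by ring)))
    exact le_of_mul_le_mul_right h2 hV0
  have hexp : crossCurv f u v V V (a - b) (a - b) = crossCurv f u v V V a a -
      crossCurv f u v V V a b - crossCurv f u v V V b a + crossCurv f u v V V b b := by
    simp only [crossCurv, map_sub, sub_apply]
    ring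
  have h0 := hnn V (a - b) hnull
  rw [hexp] at h0
  have c1 := (abs_le.1 (hb.cross_le V V a b)).1
  have c2 := (abs_le.1 (hb.cross_le V V b a)).1
  have c3 := (abs_le.1 (hb.cross_le V V b b)).2
  have c4 : A * (‖V‖ * ‖V‖ * ‖b‖ * ‖b‖) ≤ A * (‖V‖ * ‖V‖ * ‖b‖ * (A ^ 2 * ‖a‖)) := by gcongr
  have c5 : (A * (2 + A ^ 2) * ‖V‖ * ‖a‖) * (‖b‖ * ‖V‖) ≤
      (A * (2 + A ^ 2) * ‖V‖ * ‖a‖) * (A * |B a V|) := by gcongr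
  linarith

variable {M : Type*} [TopologicalSpace M] [ChartedSpace (Model n) M]
  {N : Type*} [TopologicalSpace N] [ChartedSpace (Model n) N]

/-- The condition (A3w) in terms of vectors only. -/
def CrossNonneg (n : ℕ) {M : Type*} [TopologicalSpace M] [ChartedSpace (Model n) M]
    {N : Type*} [TopologicalSpace N] [ChartedSpace (Model n) N]
    (c : M → N → ℝ) (Ω : Set M) (Ω' : Set N) : Prop :=
  ∀ φ ∈ smoothAtlas n M, ∀ ψ ∈ smoothAtlas n N, ∀ x ∈ Ω ∩ φ.source, ∀ y ∈ Ω' ∩ ψ.source,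
    ∀ V a : Model n, dY (dX (localRep c φ ψ)) (φ x) (ψ y) a V = 0 →
      0 ≤ crossCurv (localRep c φ ψ) (φ x) (ψ y) V V a a

variable {c : M → N → ℝ} {Ω : Set M} {Ω' : Set N}

theorem RegularCost.a3w_iff (h : RegularCost n c Ω Ω') :
    A3w (n := n) c Ω Ω' ↔ CrossNonneg n c Ω Ω' := by
  constructor
  · intro H φ hφ ψ hψ x hx y hy V a hVa
    have := H φ hφ ψ hψ x hx y hy V _ hVa
    rwa [MTW_eq_crossCurv,
      inverse_apply_of_isInvertible (h.invertible φ hφ ψ hψ _ (mem_chartProd hx hy))] at this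
  · intro H φ hφ ψ hψ x hx y hy V η hη
    rw [MTW_eq_crossCurv]
    refine H φ hφ ψ hψ x hx y hy V _ ?_
    rwa [apply_inverse_of_isInvertible (h.invertible φ hφ ψ hψ _ (mem_chartProd hx hy))]

theorem CrossNonneg.flip (hn : CrossNonneg n c Ω Ω') (h : RegularCost n c Ω Ω') :
    CrossNonneg n (flip c) Ω' Ω := by
  intro ψ hψ φ hφ y hy x hx a V hVa
  have hq := mem_chartProd hx hy
  have hm := h.mixed φ hφ ψ hψ
  have e : dY (dX (localRep (_root_.flip c) ψ φ)) (ψ y) (φ x) = _ :=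
    hm.dX_dY (h.isOpen_prod _ _) hq
  rw [e] at hVa
  have e2 := crossCurv_flip hm (h.isOpen_prod _ _) hq (h.invertible φ hφ ψ hψ _ hq) V V a a
  change 0 ≤ crossCurv (_root_.flip (localRep c φ ψ)) (ψ y) (φ x) a a V V
  rw [e2]
  exact hn φ hφ ψ hψ x hx y hy V a hVa

/-- The first of the two inequalities of quantitative quasiconvexity; the second one is the first
one for the cost with exchanged variables. -/
def QQConvLeft (n : ℕ) {M : Type*} [TopologicalSpace M] [ChartedSpace (Model n) M]
    {N : Type*} (K : ℝ) (c : M → N → ℝ) (Ω : Set M) (Ω' : Set N) : Prop :=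
  ∀ x ∈ Ω, ∀ x₀ ∈ Ω, ∀ y₀ ∈ Ω', ∀ y₁ ∈ Ω', ∀ γ : ℝ → N, IsCSegment n c Ω' x₀ y₀ y₁ γ →
    ∀ t ∈ Icc (0 : ℝ) 1,
      -c x (γ t) + c x y₀ - (-c x₀ (γ t) + c x₀ y₀)
        ≤ K * t * max (-c x y₁ + c x y₀ - (-c x₀ y₁ + c x₀ y₀)) 0

end Nonneg

theorem QQConvLeft.mono {n : ℕ} {M : Type*} [TopologicalSpace M] [ChartedSpace (Model n) M]
    {N : Type*} {c : M → N → ℝ} {Ω : Set M} {Ω' : Set N} {K K' : ℝ}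
    (hQ : QQConvLeft n K c Ω Ω') (hK : K ≤ K') :
    QQConvLeft n K' c Ω Ω' := by
  intro x hx x₀ hx₀ y₀ hy₀ y₁ hy₁ γ hγ t ht
  refine (hQ x hx x₀ hx₀ y₀ hy₀ y₁ hy₁ γ hγ t ht).trans ?_
  have := ht.1
  have : 0 ≤ max (-c x y₁ + c x y₀ - (-c x₀ y₁ + c x₀ y₀)) 0 := le_max_right _ _
  gcongr

section Equivalence

variable {n : ℕ} {M : Type*} [TopologicalSpace M] [ChartedSpace (Model n) M]
  {N : Type*} [TopologicalSpace N] [ChartedSpace (Model n) N]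
  {c : M → N → ℝ} {Ω : Set M} {Ω' : Set N}

/-- For `a`, `w` the velocity and acceleration of a `c`-segment with respect to `σ 0`, the function
`Φ` of `IsSegmentOn.exists_deriv_hess` has a critical point at `0`. -/
theorem IsSegmentOn.deriv_hess_zero (h : RegularCost n c Ω Ω')
    {ψ : OpenPartialHomeomorph N (Model n)} (hψ : ψ ∈ smoothAtlas n N)
    {y : N} (hy : y ∈ Ω') (hyψ : y ∈ ψ.source)
    {q₀ q₁ : Model n →L[ℝ] ℝ} {σ : ℝ → M} {J : Set ℝ}
    (hσ : IsSegmentOn ψ (flip c) Ω y q₀ q₁ σ J) {a w : Model n}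
    (h0 : (0 : ℝ) ∈ J) {φ : OpenPartialHomeomorph M (Model n)} (hφ : φ ∈ smoothAtlas n M)
    (hφ0 : σ 0 ∈ φ.source)
    (haw : dY (dX (localRep c φ ψ)) (φ (σ 0)) (ψ y) w +
        dY (dY (dX (localRep c φ ψ))) (φ (σ 0)) (ψ y) a a = 0) :
    deriv (fun s => hessD ψ (flip c) y (σ s) a a + covD ψ (flip c) y (σ s) w) 0 = 0 := by
  obtain ⟨V, hV, h1, -⟩ := hσ.exists_deriv_hess h hψ hy hyψ a w h0 hφ hφ0
  rw [h1.deriv, ← hV, ContinuousLinearMap.flip_apply, add_comm]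
  exact congrArg (fun L : Model n →L[ℝ] ℝ => L V) haw

variable [IsManifold 𝓘(ℝ, Model n) ∞ M] [IsManifold 𝓘(ℝ, Model n) ∞ N]

/-- Derivatives of the difference of two costs along a `c`-segment. -/
theorem IsSegmentOn.exists_deriv_sub (h : RegularCost n c Ω Ω')
    {φ : OpenPartialHomeomorph M (Model n)} (hφ : φ ∈ smoothAtlas n M)
    {x₀ : M} (hx₀ : x₀ ∈ Ω) (hxφ : x₀ ∈ φ.source)
    {p₀ p₁ : Model n →L[ℝ] ℝ} {γ : ℝ → N} {I : Set ℝ} (hγ : IsSegmentOn φ c Ω' x₀ p₀ p₁ γ I)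
    {t : ℝ} (ht : t ∈ I) {ψ : OpenPartialHomeomorph N (Model n)} (hψ : ψ ∈ smoothAtlas n N)
    (hψt : γ t ∈ ψ.source) :
    ∃ a w, dY (dX (localRep c φ ψ)) (φ x₀) (ψ (γ t)) a = p₁ ∧
      dY (dX (localRep c φ ψ)) (φ x₀) (ψ (γ t)) w +
        dY (dY (dX (localRep c φ ψ))) (φ x₀) (ψ (γ t)) a a = 0 ∧
      ∀ x ∈ Ω, HasDerivAt (fun t => -c x (γ t) + c x₀ (γ t))
          (-((covD ψ (flip c) (γ t) x - covD ψ (flip c) (γ t) x₀) a)) t ∧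
        HasDerivAt (deriv fun t => -c x (γ t) + c x₀ (γ t))
          (-((hessD ψ (flip c) (γ t) x a a + covD ψ (flip c) (γ t) x w) -
            (hessD ψ (flip c) (γ t) x₀ a a + covD ψ (flip c) (γ t) x₀ w))) t := by
  obtain ⟨a, w, ha, haw, H⟩ := hγ.exists_deriv_cost h hφ hx₀ hxφ ht hψ hψt
  refine ⟨a, w, ha, haw, fun x hx => ⟨?_, ?_⟩⟩
  · refine ((H x hx).1.neg.add (H x₀ hx₀).1).congr_deriv ?_
    simp only [sub_apply]; ring
  · have hd : ∀ r ∈ I, ∀ x' ∈ Ω, DifferentiableAt ℝ (fun t => c x' (γ t)) r := by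
      intro r hr x' hx'
      obtain ⟨_, _, -, -, H'⟩ := hγ.exists_deriv_cost h hφ hx₀ hxφ hr
        (IsManifold.chart_mem_maximalAtlas (γ r)) (mem_chart_source (Model n) (γ r))
      exact (H' x' hx').1.differentiableAt
    have heq : (deriv fun t => -c x (γ t) + c x₀ (γ t)) =ᶠ[𝓝 t]
        fun r => -deriv (fun t => c x (γ t)) r + deriv (fun t => c x₀ (γ t)) r := by
      filter_upwards [hγ.isOpen.mem_nhds ht] with r hr
      exact ((hd r hr x hx).hasDerivAt.neg.add (hd r hr x₀ hx₀).hasDerivAt).deriv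
    refine (((H x hx).2.neg.add (H x₀ hx₀).2).congr_of_eventuallyEq heq).congr_deriv ?_
    ring

/-- `c`-convexity: the `c`-segment between two points extends to an open interval of parameters. -/
theorem RegularCost.exists_isSegmentOn_between (h : RegularCost n c Ω Ω')
    {φ : OpenPartialHomeomorph M (Model n)} (hφ : φ ∈ smoothAtlas n M)
    {x : M} (hx : x ∈ Ω) (hxφ : x ∈ φ.source) {y₀ y₁ : N} (hy₀ : y₀ ∈ Ω') (hy₁ : y₁ ∈ Ω') :
    ∃ γ I, IsSegmentOn φ c Ω' x (covD φ c x y₀) (covD φ c x y₁ - covD φ c x y₀) γ I ∧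
      Icc 0 1 ⊆ I ∧ γ 0 = y₀ ∧ γ 1 = y₁ ∧
      ∀ γ', IsCSegment n c Ω' x y₀ y₁ γ' → EqOn γ γ' (Icc 0 1) := by
  have : Nonempty N := ⟨y₀⟩
  obtain ⟨γ, I, hγ, hG⟩ := h.exists_isSegmentOn hφ hx hxφ (covD φ c x y₀)
    (covD φ c x y₁ - covD φ c x y₀)
  have key : ∀ γ', IsCSegment n c Ω' x y₀ y₁ γ' → ∀ t ∈ Icc (0 : ℝ) 1, t ∈ I ∧ γ t = γ' t := by
    intro γ' hγ' t ht
    obtain ⟨h1, h2⟩ := (h.isCSegment_iff hφ hx hxφ hy₀ hy₁).1 hγ' t ht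
    refine hG t _ h1 ?_
    rw [h2]; module
  obtain ⟨γ', hγ'⟩ := h.domConv.2 x hx y₀ hy₀ y₁ hy₁
  refine ⟨γ, I, hγ, fun t ht => (key γ' hγ' t ht).1, (hG 0 y₀ hy₀ (by simp)).2,
    (hG 1 y₁ hy₁ (by simp)).2, fun γ'' hγ'' t ht => (key γ'' hγ'' t ht).2⟩

/-- Nonnegative cross-curvature implies the differential inequality `f'' ≥ -C |f'|` for the
difference `f` of two costs along any `c`-segment, and hence quantitative quasiconvexity. -/
theorem RegularCost.exists_qqConvLeft (h : RegularCost n c Ω Ω') (hn : CrossNonneg n c Ω Ω') :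
    ∃ K, 1 ≤ K ∧ QQConvLeft n K c Ω Ω' := by
  obtain ⟨A, k, k', hk, hk', hb⟩ := h.bound
  rcases Ω.eq_empty_or_nonempty with rfl | ⟨z, hz⟩
  · exact ⟨1, le_rfl, fun x hx => absurd hx (notMem_empty x)⟩
  rcases Ω'.eq_empty_or_nonempty with rfl | ⟨z', hz'⟩
  · exact ⟨1, le_rfl, fun x _ x₀ _ y hy => absurd hy (notMem_empty y)⟩
  have hA : 0 ≤ A := (norm_nonneg _).trans (hb z hz z' hz').dX_le
  set C := A ^ 2 * (2 + A ^ 2) * (A * (2 * A)) * (A * (2 * A)) with hC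
  have hC0 : 0 ≤ C := by positivity
  refine ⟨Real.exp (C + 1), Real.one_le_exp (by linarith), ?_⟩
  intro x hx x₀ hx₀ y₀ hy₀ y₁ hy₁ γ' hγ' t ht
  obtain ⟨γ, I, hγ, hI, e0, e1, heq⟩ :=
    h.exists_isSegmentOn_between (hk x₀ hx₀).1 hx₀ (hk x₀ hx₀).2 hy₀ hy₁
  have hp₁ : ‖covD (k x₀) c x₀ y₁ - covD (k x₀) c x₀ y₀‖ ≤ 2 * A := by
    have b1 := (hb x₀ hx₀ y₁ hy₁).dX_le
    have b0 := (hb x₀ hx₀ y₀ hy₀).dX_le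
    rw [dX_localRep c _ (hk' _ hy₁).2] at b1
    rw [dX_localRep c _ (hk' _ hy₀).2] at b0
    exact (norm_sub_le _ _).trans (by linarith)
  set f := fun t => -c x (γ t) + c x₀ (γ t) with hf
  have main : ∀ t ∈ Icc (0 : ℝ) 1, DifferentiableAt ℝ f t ∧
      ∃ l, HasDerivAt (deriv f) l t ∧ -(C * |deriv f t|) ≤ l := by
    intro t ht
    have hy : γ t ∈ Ω' := hγ.mem t (hI ht)
    set y := γ t with hydef
    obtain ⟨hψ, hyψ⟩ := hk' y hy
    obtain ⟨a, w, ha, haw, H⟩ :=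
      hγ.exists_deriv_sub h (hk x₀ hx₀).1 hx₀ (hk x₀ hx₀).2 (hI ht) hψ hyψ
    obtain ⟨H1, H2⟩ := H x hx
    refine ⟨H1.differentiableAt, _, H2, ?_⟩
    rw [H1.deriv, abs_neg]
    obtain ⟨σ, J, hσ, hJ, s0, s1, -⟩ :=
      h.flip.exists_isSegmentOn_between hψ hy hyψ hx₀ hx
    have hq₁ : ‖covD (k' y) (_root_.flip c) y x - covD (k' y) (_root_.flip c) y x₀‖ ≤ 2 * A := by
      have b1 := (hb x hx y hy).dY_le
      have b0 := (hb x₀ hx₀ y hy).dY_le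
      rw [dY_localRep c (hk _ hx).2] at b1
      rw [dY_localRep c (hk _ hx₀).2] at b0
      exact (norm_sub_le _ _).trans (by linarith)
    set q₁ := covD (k' y) (_root_.flip c) y x - covD (k' y) (_root_.flip c) y x₀ with hq₁def
    have hna : ‖a‖ ≤ A * (2 * A) := by
      refine ((hb x₀ hx₀ y hy).le_dYX a).trans ?_
      rw [ha]
      gcongr
    set Φ := fun s => hessD (k' y) (_root_.flip c) y (σ s) a a +
      covD (k' y) (_root_.flip c) y (σ s) w with hΦ
    have hdΦ : ∀ s ∈ Icc (0 : ℝ) 1, DifferentiableAt ℝ Φ s ∧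
        ∃ l, HasDerivAt (deriv Φ) l s ∧ l ≤ C * |q₁ a| := by
      intro s hs
      have hσs := hσ.mem s (hJ hs)
      obtain ⟨hφ, hφs⟩ := hk _ hσs
      obtain ⟨V, hV, D1, D2⟩ := hσ.exists_deriv_hess h hψ hy hyψ a w (hJ hs) hφ hφs
      refine ⟨D1.differentiableAt, _, D2, ?_⟩
      have hbs := hb _ hσs y hy
      have hlow := hbs.neg_le_crossCurv (h.invertible _ hφ _ hψ _ (mem_chartProd ⟨hσs, hφs⟩
        ⟨hy, hyψ⟩)) (hn _ hφ _ hψ _ ⟨hσs, hφs⟩ _ ⟨hy, hyψ⟩) V a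
      have hnV : ‖V‖ ≤ A * (2 * A) := by
        refine (hbs.le_dYX_flip V).trans ?_
        rw [hV]
        gcongr
      -- the pairing of `V` and `a` is constant along `σ`
      have hpair : dY (dX (localRep c (k (σ s)) (k' y))) (k (σ s) (σ s)) (k' y y) a V = q₁ a := by
        rw [← hV]; rfl
      rw [hpair] at hlow
      have : A ^ 2 * (2 + A ^ 2) * ‖V‖ * ‖a‖ * |q₁ a| ≤ C * |q₁ a| := by
        rw [hC]; gcongr
      linarith
    have hcrit : deriv Φ 0 = 0 := by
      refine hσ.deriv_hess_zero h hψ hy hyψ (hJ ⟨le_rfl, zero_le_one⟩) (hk x₀ hx₀).1 ?_ ?_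
      · rw [s0]; exact (hk x₀ hx₀).2
      · rw [s0]; exact haw
    obtain ⟨ξ, hξ, ζ, hζ, eΦ⟩ := exists_sub_eq_mul_of_deriv_eq_zero (Φ := Φ)
      (Φ₂ := deriv (deriv Φ)) one_pos (fun s hs => (hdΦ s hs).1)
      (fun s hs => (hdΦ s hs).2.choose_spec.1.differentiableAt.hasDerivAt) hcrit
    obtain ⟨-, l, hl, hle⟩ := hdΦ ζ ⟨hζ.1.le, hζ.2.le.trans hξ.2.le⟩
    rw [hl.deriv] at eΦ
    have e2 : Φ 1 - Φ 0 =
        (hessD (k' y) (_root_.flip c) y x a a + covD (k' y) (_root_.flip c) y x w) -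
          (hessD (k' y) (_root_.flip c) y x₀ a a + covD (k' y) (_root_.flip c) y x₀ w) := by
      simp only [hΦ, s0, s1]
    rw [← e2, eΦ, one_mul]
    have hCq : 0 ≤ C * |q₁ a| := by positivity
    have : ξ * l ≤ C * |q₁ a| :=
      calc ξ * l ≤ ξ * (C * |q₁ a|) := mul_le_mul_of_nonneg_left hle hξ.1.le
        _ ≤ 1 * (C * |q₁ a|) := mul_le_mul_of_nonneg_right hξ.2.le hCq
        _ = _ := one_mul _
    linarith
  have := sub_le_of_neg_abs_deriv_le (f := f) (f₂ := deriv (deriv f)) hC0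
    (fun t ht => (main t ht).1)
    (fun t ht => (main t ht).2.choose_spec.1.differentiableAt.hasDerivAt)
    (fun t ht => by
      obtain ⟨-, l, hl, hle⟩ := main t ht
      rwa [hl.deriv]) ht
  simp only [hf, e0, e1, heq γ' hγ' ht] at this
  convert this using 1
  · ring
  · congr 2; ring

/-- If the cross-curvature is negative at a null pair `(V, a)`, then the difference of two costs has
a strict local maximum in the interior of a `c`-segment, which contradicts quasiconvexity. -/
theorem QQConvLeft.crossNonneg {K : ℝ} (hQ : QQConvLeft n K c Ω Ω') (h : RegularCost n c Ω Ω') :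
    CrossNonneg n c Ω Ω' := by
  intro φ hφ ψ hψ x₀ hx₀ y₀ hy₀ V a hVa
  by_contra! hneg
  have : Nonempty M := ⟨x₀⟩
  have : Nonempty N := ⟨y₀⟩
  have hm := h.mixed φ hφ ψ hψ
  have hinv := h.invertible φ hφ ψ hψ
  set f := localRep c φ ψ with hfdef
  set B := dY (dX f) (φ x₀) (ψ y₀) with hBdef
  have hB : B.IsInvertible := hinv _ (mem_chartProd hx₀ hy₀)
  obtain ⟨γ, I, hγ, hG⟩ := h.exists_isSegmentOn hφ hx₀.1 hx₀.2 (covD φ c x₀ y₀) (B a)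
  obtain ⟨h0I, e0⟩ := hG 0 y₀ hy₀.1 (by simp)
  obtain ⟨a', w, ha', haw, H⟩ :=
    hγ.exists_deriv_sub h hφ hx₀.1 hx₀.2 h0I hψ (by rw [e0]; exact hy₀.2)
  rw [e0] at ha' haw H
  obtain rfl : a' = a := by
    rw [← inverse_apply_of_isInvertible hB a', ha', inverse_apply_of_isInvertible hB a]
  obtain ⟨σ, J, hσ, hG'⟩ := h.flip.exists_isSegmentOn hψ hy₀.1 hy₀.2 (covD ψ (flip c) y₀ x₀)
    (B.flip V)
  obtain ⟨h0J, s0⟩ := hG' 0 x₀ hx₀.1 (by simp)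
  -- the cross-curvature stays negative along a short piece of the segment `σ`
  have hOpen : ∀ᶠ s in 𝓝 (0 : ℝ), s ∈ J ∧ σ s ∈ φ.source :=
    (hσ.isOpen.eventually_mem h0J).and ((hσ.continuousAt 0 h0J).preimage_mem_nhds
      (φ.open_source.mem_nhds (by rw [s0]; exact hx₀.2)))
  set J' := {s | s ∈ J ∧ σ s ∈ φ.source} with hJ'
  set Bs := fun s => (dY (dX f) (φ (σ s)) (ψ y₀)).flip with hBs
  have hqS : MapsTo (fun s => (φ (σ s), ψ y₀)) J' (chartProd Ω Ω' φ ψ) := fun s hs =>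
    mem_chartProd ⟨hσ.mem s hs.1, hs.2⟩ hy₀
  have hqc : ContinuousOn (fun s => (φ (σ s), ψ y₀)) J' := fun s hs =>
    (ContinuousAt.prodMk ((φ.continuousAt hs.2).comp (hσ.continuousAt s hs.1))
      continuousAt_const).continuousWithinAt
  have hBsi : ∀ s ∈ J', (Bs s).IsInvertible := fun s hs => isInvertible_flip (hinv _ (hqS hs))
  have hVc : ContinuousOn (fun s => (Bs s).inverse (B.flip V)) J' :=
    (continuousOn_inverse ((transposeL (Model n) ℝ).continuous.comp_continuousOn
      (hm.c₁₁.comp hqc hqS)) hBsi).clm_apply continuousOn_const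
  have hcc := continuousOn_crossCurv hm hinv a' a' hqc hqS hVc hVc
  have hV0 : (Bs 0).inverse (B.flip V) = V := by
    have : Bs 0 = B.flip := by simp only [hBs, s0, hBdef]
    rw [this, inverse_apply_of_isInvertible (isInvertible_flip hB)]
  have hneg' : ∀ᶠ s in 𝓝 (0 : ℝ), crossCurv f (φ (σ s)) (ψ y₀) ((Bs s).inverse (B.flip V))
      ((Bs s).inverse (B.flip V)) a' a' < 0 := by
    refine (hcc.continuousAt hOpen).eventually_lt_const ?_
    simp only [hV0, s0]
    exact hneg
  obtain ⟨δ, hδ, hball⟩ := Metric.eventually_nhds_iff_ball.1 (hOpen.and hneg')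
  set s₁ := δ / 2 with hs₁
  have hs₁0 : 0 < s₁ := by positivity
  have hin : ∀ s ∈ Icc 0 s₁, s ∈ Metric.ball (0 : ℝ) δ := fun s hs => by
    rw [Metric.mem_ball, dist_zero_right, Real.norm_eq_abs, abs_of_nonneg hs.1]
    linarith [hs.2]
  set Φ := fun s => hessD ψ (flip c) y₀ (σ s) a' a' + covD ψ (flip c) y₀ (σ s) w with hΦ
  have hdΦ : ∀ s ∈ Icc 0 s₁, DifferentiableAt ℝ Φ s ∧ ∃ l, HasDerivAt (deriv Φ) l s ∧ 0 < l := by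
    intro s hs
    obtain ⟨hsJ, hsn⟩ := hball s (hin s hs)
    obtain ⟨V', hV', D1, D2⟩ := hσ.exists_deriv_hess h hψ hy₀.1 hy₀.2 a' w hsJ.1 hφ hsJ.2
    refine ⟨D1.differentiableAt, _, D2, ?_⟩
    have : (Bs s).inverse (B.flip V) = V' := by
      rw [← hV']
      exact inverse_apply_of_isInvertible (hBsi s hsJ) V'
    rw [this] at hsn
    linarith
  have hcrit : deriv Φ 0 = 0 := by
    refine hσ.deriv_hess_zero h hψ hy₀.1 hy₀.2 h0J hφ ?_ ?_
    · rw [s0]; exact hx₀.2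
    · rw [s0]; exact haw
  obtain ⟨ξ, hξ, ζ, hζ, eΦ⟩ := exists_sub_eq_mul_of_deriv_eq_zero (Φ := Φ)
    (Φ₂ := deriv (deriv Φ)) hs₁0 (fun s hs => (hdΦ s hs).1)
    (fun s hs => (hdΦ s hs).2.choose_spec.1.differentiableAt.hasDerivAt) hcrit
  obtain ⟨-, l, hl, hlpos⟩ := hdΦ ζ ⟨hζ.1.le, hζ.2.le.trans hξ.2.le⟩
  rw [hl.deriv] at eΦ
  have hs₁J : s₁ ∈ J := (hball s₁ (hin s₁ ⟨hs₁0.le, le_rfl⟩)).1.1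
  set x := σ s₁ with hx
  have hxΩ : x ∈ Ω := hσ.mem s₁ hs₁J
  obtain ⟨H1, H2⟩ := H x hxΩ
  set g := fun t => -c x (γ t) + c x₀ (γ t) with hg
  have hg0 : deriv g 0 = 0 := by
    rw [H1.deriv, hσ.covD_eq s₁ hs₁J]
    have : B.flip V a' = 0 := hVa
    simp [this]
  have hl2 : -((hessD ψ (flip c) y₀ x a' a' + covD ψ (flip c) y₀ x w) -
      (hessD ψ (flip c) y₀ x₀ a' a' + covD ψ (flip c) y₀ x₀ w)) < 0 := by
    have e2 : Φ s₁ - Φ 0 = (hessD ψ (flip c) y₀ x a' a' + covD ψ (flip c) y₀ x w) -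
        (hessD ψ (flip c) y₀ x₀ a' a' + covD ψ (flip c) y₀ x₀ w) := by
      simp only [hΦ, s0, hx]
    rw [← e2, eΦ]
    have : 0 < s₁ * ξ * l := mul_pos (mul_pos hs₁0 hξ.1) hlpos
    linarith
  have hgd : ∀ᶠ t in 𝓝 (0 : ℝ), DifferentiableAt ℝ g t := by
    filter_upwards [hγ.isOpen.mem_nhds h0I] with t ht
    obtain ⟨_, _, -, -, H'⟩ := hγ.exists_deriv_sub h hφ hx₀.1 hx₀.2 ht
      (IsManifold.chart_mem_maximalAtlas (γ t)) (mem_chart_source (Model n) (γ t))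
    exact (H' x hxΩ).1.differentiableAt
  have hmax := eventually_lt_of_deriv_deriv_neg hl2 hgd hg0 H2
  obtain ⟨ε, hε, hεI⟩ := Metric.isOpen_iff.1 hγ.isOpen 0 h0I
  obtain ⟨τ, ⟨hτ1, hτ2⟩, hτ⟩ := (hmax.and (Ioo_mem_nhdsGT hε)).exists
  -- quasiconvexity along the segment through `γ (-r)`, `γ 0` and `γ r`
  have hqc : ∀ r, |r| = τ → g 0 - g (-r) ≤ K * (1 / 2) * max (g r - g (-r)) 0 := by
    intro r hr
    have hmem : ∀ t, |t| ≤ τ → t ∈ I := fun t ht => hεI (by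
      rw [Metric.mem_ball, dist_zero_right, Real.norm_eq_abs]; linarith [hτ.2])
    have hrI : r ∈ I := hmem r hr.le
    have hrI' : -r ∈ I := hmem (-r) (by rw [abs_neg, hr])
    have hseg : IsCSegment n c Ω' x₀ (γ (-r)) (γ r) fun t => γ ((2 * t - 1) * r) := by
      rw [h.isCSegment_iff hφ hx₀.1 hx₀.2 (hγ.mem _ hrI') (hγ.mem _ hrI)]
      intro t ht
      have htI : (2 * t - 1) * r ∈ I := hmem _ (by
        rw [abs_mul, hr]
        have : |2 * t - 1| ≤ 1 := abs_le.2 ⟨by linarith [ht.1], by linarith [ht.2]⟩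
        have hτ0 := hτ.1
        nlinarith)
      refine ⟨hγ.mem _ htI, ?_⟩
      rw [hγ.covD_eq _ htI, hγ.covD_eq _ hrI, hγ.covD_eq _ hrI']
      module
    have := hQ x hxΩ x₀ hx₀.1 _ (hγ.mem _ hrI') _ (hγ.mem _ hrI) _ hseg (1 / 2)
      ⟨by norm_num, by norm_num⟩
    simp only [show (2 * (1 / 2 : ℝ) - 1) * r = 0 by ring] at this
    convert this using 1
    · simp only [hg]; ring
    · congr 2; simp only [hg]; ring
  have q1 := hqc τ (abs_of_pos hτ.1)
  have q2 := hqc (-τ) (by rw [abs_neg, abs_of_pos hτ.1])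
  rw [neg_neg] at q2
  rcases le_total (g τ) (g (-τ)) with hle | hle
  · rw [max_eq_right (by linarith)] at q1
    linarith
  · rw [max_eq_right (by linarith)] at q2
    linarith

theorem RegularCost.a3w_iff_qqConv (h : RegularCost n c Ω Ω') :
    A3w (n := n) c Ω Ω' ↔ QQConv n c Ω Ω' := by
  rw [h.a3w_iff]
  constructor
  · intro hn
    obtain ⟨K, hK, hQ⟩ := h.exists_qqConvLeft hn
    obtain ⟨K', -, hQ'⟩ := h.flip.exists_qqConvLeft (hn.flip h)
    have hQ := hQ.mono (le_max_left K K')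
    have hQ' := hQ'.mono (le_max_right K K')
    exact ⟨max K K', hK.trans (le_max_left _ _), fun x hx x₀ hx₀ x₁ hx₁ y hy y₀ hy₀ y₁ hy₁ =>
      ⟨hQ x hx x₀ hx₀ y₀ hy₀ y₁ hy₁, hQ' y hy y₀ hy₀ x₀ hx₀ x₁ hx₁⟩⟩
  · rintro ⟨K, -, hQ⟩
    have hL : QQConvLeft n K c Ω Ω' := fun x hx x₀ hx₀ y₀ hy₀ y₁ hy₁ =>
      (hQ x hx x₀ hx₀ x₀ hx₀ y₀ hy₀ y₀ hy₀ y₁ hy₁).1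
    exact hL.crossNonneg h

end Equivalence

end CConvexGeometry

theorem mainTheorem3 (n : ℕ)
    {M : Type*} [TopologicalSpace M] [T2Space M] [ChartedSpace (CConvexGeometry.Model n) M]
    [IsManifold 𝓘(ℝ, CConvexGeometry.Model n) ∞ M]
    {N : Type*} [TopologicalSpace N] [T2Space N] [ChartedSpace (CConvexGeometry.Model n) N]
    [IsManifold 𝓘(ℝ, CConvexGeometry.Model n) ∞ N]
    (Ω : Set M) (hΩ : IsOpen Ω) (hΩ_conn : IsConnected Ω) (hΩ_cpt : IsCompact (closure Ω))
    (Ω' : Set N) (hΩ' : IsOpen Ω') (hΩ'_conn : IsConnected Ω') (hΩ'_cpt : IsCompact (closure Ω'))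
    (c : M → N → ℝ)
    (hc : CConvexGeometry.IsMixedC4 (n := n) c Ω Ω')
    (hTwist : CConvexGeometry.Twist n c Ω Ω')
    (hNondeg : CConvexGeometry.Nondeg (n := n) c Ω Ω')
    (hDomConv : CConvexGeometry.DomConv n c Ω Ω') :
    CConvexGeometry.A3w (n := n) c Ω Ω' ↔ CConvexGeometry.QQConv n c Ω Ω' := by
  exact (CConvexGeometry.regularCost_of_compact hΩ hΩ_cpt hΩ' hΩ'_cpt hc hTwist hNondeg
    hDomConv).a3w_iff_qqConv
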